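/- **Setting.** Let $\|\cdot\|$ be the Euclidean norm. Let $w\in\mathbb R^n$ have non-negative entries with $\max_i w_i\le\sqrt{\sum_k w_k}$, and write $w_{\max}=\max_i w_i$ and $\tilde d=\frac{\sum_i w_i^2}{\sum_i w_i}$. A $G(w)$ graph is a random undirected graph on $n$ vertices in which every edge $\{i,j\}$ is included independently with probability $\frac{w_iw_j}{\sum_k w_k}$; self-loops ($i=j$) are either included with this probability for every $i$, or excluded altogether, and the result is claimed in both cases. Let $A\in\{0,1\}^{n\times n}$ be its (symmetric) adjacency matrix and let $w^*$, $w^*_i=\sum_j A_{ij}$, be its realized degree vector. For $\varepsilon,\delta\in(0,1)$, the $G(w)$ graph satisfies *$(\varepsilon,\delta)$-concentration* if $$\tfrac49\log\tfrac{2n}{\delta}\ \le\ w_{\max}\ \le\ \tfrac{\|w\|}{6}\qquad\text{and}\qquad \tilde d\ \ge\ \frac{256\left(\sqrt{4\,w_{\max}\log(2n/\delta)}+1\right)}{\varepsilon^2}.$$ For standalone values $b\in\mathbb R^n$ and $\beta>0$, agent $i$ has utility $u_i(a)=b_ia_i-\frac12a_i^2+\beta\sum_jA_{ij}a_ia_j$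 at the action profile $a$. An intervention $y\in\mathbb R^n$ replaces $b$ by $b+y$; the equilibrium actions are then $a^*=(I-\beta A)^{-1}(b+y)$, and $W(y)=\sum_iu_i(a^*)$ is the social welfare at equilibrium (with the utilities $u_i$ taken for the standalone values $b+y$). For a budget $C>0$, $y^*$ denotes a maximizer of $W$ over $\{x:\|x\|=\sqrt C\}$, and the competitive ratio of $y$ is $W(y)/W(y^*)$. **Lemma.** There is an absolute constant $K>0$ such that the following holds. For every $G(w)$ graph that satisfies $(\varepsilon,\delta)$-concentration, with probability at least $1-K\delta$ over the draw of $A$, 1. $\|w-w^*\|\le K\varepsilon\|w\|$, and 2. for all $b$ with non-negative entries, all $\beta>0$ such that the spectral radius of $A$ is less than $1/\beta$, and all budgets $C>0$ with $C\ge\frac{256\|b\|^2}{(\varepsilon\beta\tilde d)^2}$, the intervention $y=\sqrt C\,\frac{w^*}{\|w^*\|}$ proportional to the realized degrees (read as $y=0$ if $w^*=0$) satisfies $$\frac{W(y)}{W(y^*)}\ \ge\ 1-K\varepsilon$$ for every maximizer $y^*$. -/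

import Mathlib

open MeasureTheory ProbabilityTheory
open scoped Matrix

noncomputable section

namespace NetworkIntervention

/-- Individual utility of agent `i` in the linear-quadratic network game with adjacency matrix `A`,
standalone marginal values `b` and network parameter `β`, at the action profile `a`. -/
def utility {n : ℕ} (A : Matrix (Fin n) (Fin n) ℝ) (β : ℝ) (b a : EuclideanSpace ℝ (Fin n))
    (i : Fin n) : ℝ :=
  b i * a i - 1 / 2 * a i ^ 2 + β * ∑ j, A i j * a i * a j

/-- The equilibrium actions `(I - β A)⁻¹ b`, i.e. the solution of the best-response equation
`a = b + β A a` (unique when `I - β A` is invertible). -/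
def equilibrium {n : ℕ} (A : Matrix (Fin n) (Fin n) ℝ) (β : ℝ) (b : EuclideanSpace ℝ (Fin n)) :
    EuclideanSpace ℝ (Fin n) :=
  WithLp.toLp 2 ((1 - β • A)⁻¹ *ᵥ b.ofLp)

/-- Social welfare `W(y)`: the sum of utilities at equilibrium after the intervention `y`, which
changes the standalone values from `b` to `b + y`. -/
def welfare {n : ℕ} (A : Matrix (Fin n) (Fin n) ℝ) (β : ℝ) (b y : EuclideanSpace ℝ (Fin n)) : ℝ :=
  ∑ i, utility A β (b + y) (equilibrium A β (b + y)) i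

/-- `z` maximizes the welfare among the interventions of Euclidean norm `√C`. -/
def IsOptimalIntervention {n : ℕ} (A : Matrix (Fin n) (Fin n) ℝ) (β : ℝ)
    (b : EuclideanSpace ℝ (Fin n)) (C : ℝ) (z : EuclideanSpace ℝ (Fin n)) : Prop :=
  ‖z‖ = √C ∧ ∀ x : EuclideanSpace ℝ (Fin n), ‖x‖ = √C → welfare A β b x ≤ welfare A β b z

/-- The degree vector of a graph with adjacency matrix `A`: its `i`-th entry is the `i`-th row
sum. -/
def degreeVector {n : ℕ} (A : Matrix (Fin n) (Fin n) ℝ) : EuclideanSpace ℝ (Fin n) :=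
  WithLp.toLp 2 (fun i => ∑ j, A i j)

/-- The intervention of norm `√C` proportional to the degrees of the graph. -/
def degreeIntervention {n : ℕ} (A : Matrix (Fin n) (Fin n) ℝ) (C : ℝ) :
    EuclideanSpace ℝ (Fin n) :=
  (√C / ‖degreeVector A‖) • degreeVector A

/-- `A` is the adjacency matrix of a random undirected graph whose edges (one for each unordered
pair `{i, j}`, with `i = j` allowed) are drawn independently with probabilities `p i j`. -/
structure IsIndepEdgeGraph {Ω : Type*} [MeasurableSpace Ω] (P : Measure Ω) {n : ℕ}
    (p : Matrix (Fin n) (Fin n) ℝ) (A : Ω → Matrix (Fin n) (Fin n) ℝ) : Prop where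
  measurable_entry : ∀ i j, Measurable fun ω => A ω i j
  isSymm : ∀ ω, (A ω).IsSymm
  zero_or_one : ∀ ω i j, A ω i j = 0 ∨ A ω i j = 1
  prob_edge : ∀ i j, P.real {ω | A ω i j = 1} = p i j
  indep : iIndepFun (fun (e : {e : Fin n × Fin n // e.1 ≤ e.2}) ω => A ω e.1.1 e.1.2) P

/-- Edge probabilities of the `G(w)` model: `w i * w j / ∑ k, w k`. If `loops` is `false`,
self-loops are disallowed, i.e. the diagonal is replaced by `0`. -/
def gwMatrix {n : ℕ} (loops : Bool) (w : EuclideanSpace ℝ (Fin n)) :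
    Matrix (Fin n) (Fin n) ℝ :=
  Matrix.of fun i j => if i = j ∧ loops = false then 0 else w i * w j / ∑ k, w k

/-- The largest expected degree. -/
def maxWeight {n : ℕ} (w : EuclideanSpace ℝ (Fin n)) : ℝ := ⨆ i, w i

/-- The second-order average expected degree. -/
def secondOrderAvg {n : ℕ} (w : EuclideanSpace ℝ (Fin n)) : ℝ := (∑ i, w i ^ 2) / ∑ i, w i

/-- `(ε, δ)`-concentration for the `G(w)` model. -/
structure GWConcentration {n : ℕ} (w : EuclideanSpace ℝ (Fin n)) (ε δ : ℝ) : Prop where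
  eps_mem : ε ∈ Set.Ioo (0 : ℝ) 1
  delta_mem : δ ∈ Set.Ioo (0 : ℝ) 1
  le_maxWeight : 4 / 9 * Real.log (2 * n / δ) ≤ maxWeight w
  maxWeight_le : maxWeight w ≤ ‖w‖ / 6
  le_secondOrderAvg :
    256 * (√(4 * maxWeight w * Real.log (2 * n / δ)) + 1) / ε ^ 2 ≤ secondOrderAvg w

end NetworkIntervention

end

/-! With high probability `A` acts as a quadratic form almost like the rank one matrix `d w wᵀ /
‖w‖²`, where `d` is `secondOrderAvg w`, and its degree vector is close to `w`. Everything else is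
deterministic.

Random part (`exists_exceptional_set`): both deviations are controlled by high even moments. In the
trace of `M ^ (2k+2)`, for the centred matrix `M`, one factor is expanded over the edges and
integrated by parts (`bernoulliMean_centered_mul_le`). A mean value inequality for traces
(`trace_mul_pow_sub_pow_le`) bounds the discrete derivative by the trace of `M ^ (2k)` against
squares of edge matrices. These squares are diagonal, so only the row sums of the graph appear.
Young's inequality absorbs half of the moment back into the left side, leaving moments of degrees
(`bernoulliMean_sum_pow_le`). The same scheme with norms in place of traces handles the degree
vector. Markov's inequality with `k` about `log (2n/δ)` concludes.

Deterministic part (`welfare_ratio_ge`): welfare at equilibrium is half the squared norm of the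
actions. For a unit top eigenvector `v` with eigenvalue `l` and `c = b + y`, twice the welfare times
`(1 - β l)²` lies between `⟪v, c⟫²` and `‖c‖²` (`welfare_bounds`). The possibly tiny factor `(1 - β
l)²` cancels in the ratio, so it suffices that `v` is nearly parallel to `w`, hence to the degrees,
and that `b` is negligible against the budget. No estimate of the second eigenvalue is needed. -/

noncomputable section

namespace NetworkIntervention

/-! ### Finite product Bernoulli laws: integration by parts and moments of sums. -/

section Bernoulli

variable {ι : Type*} [Fintype ι]

/-- The real number `1` or `0` attached to a Boolean. -/
def ind (b : Bool) : ℝ := if b then 1 else 0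

/-- The probability of the configuration `x` of independent Bernoulli variables with
parameters `p`. -/
def bernoulliWeight (p : ι → ℝ) (x : ι → Bool) : ℝ := ∏ e, if x e then p e else 1 - p e

theorem bernoulliWeight_nonneg {p : ι → ℝ} (hp : ∀ e, p e ∈ Set.Icc (0 : ℝ) 1) (x : ι → Bool) :
    0 ≤ bernoulliWeight p x := by
  refine Finset.prod_nonneg fun e _ => ?_
  have := hp e
  split_ifs
  · exact this.1
  · linarith [this.2]

variable [DecidableEq ι]

/-- The expectation of `f` under the product of the Bernoulli laws with parameters `p`. -/
def bernoulliMean (p : ι → ℝ) (f : (ι → Bool) → ℝ) : ℝ := ∑ x, bernoulliWeight p x * f x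

theorem bernoulliMean_mono {p : ι → ℝ} (hp : ∀ e, p e ∈ Set.Icc (0 : ℝ) 1)
    {f g : (ι → Bool) → ℝ} (h : ∀ x, f x ≤ g x) : bernoulliMean p f ≤ bernoulliMean p g :=
  Finset.sum_le_sum fun x _ => mul_le_mul_of_nonneg_left (h x) (bernoulliWeight_nonneg hp x)

theorem bernoulliMean_add (p : ι → ℝ) (f g : (ι → Bool) → ℝ) :
    bernoulliMean p (fun x => f x + g x) = bernoulliMean p f + bernoulliMean p g := by
  simp [bernoulliMean, mul_add, Finset.sum_add_distrib]

theorem bernoulliMean_const_mul (p : ι → ℝ) (c : ℝ) (f : (ι → Bool) → ℝ) :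
    bernoulliMean p (fun x => c * f x) = c * bernoulliMean p f := by
  simp only [bernoulliMean, Finset.mul_sum]
  exact Finset.sum_congr rfl fun x _ => by ring

theorem bernoulliMean_sum {κ : Type*} (s : Finset κ) (p : ι → ℝ) (f : κ → (ι → Bool) → ℝ) :
    bernoulliMean p (fun x => ∑ i ∈ s, f i x) = ∑ i ∈ s, bernoulliMean p (f i) := by
  simp only [bernoulliMean, Finset.mul_sum]
  exact Finset.sum_comm

theorem bernoulliMean_prod (p : ι → ℝ) (f : ι → Bool → ℝ) :
    bernoulliMean p (fun x => ∏ e, f e (x e)) = ∏ e, (p e * f e true + (1 - p e) * f e false) := by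
  have h := Finset.prod_univ_sum (fun _ : ι => (Finset.univ : Finset Bool))
    (fun e b => (if b then p e else 1 - p e) * f e b)
  simp only [Fintype.piFinset_univ, Fintype.sum_bool] at h
  simp only [bernoulliMean, bernoulliWeight, ← Finset.prod_mul_distrib]
  rw [← h]
  simp

theorem bernoulliWeight_update (p : ι → ℝ) (x : ι → Bool) (e : ι) (b : Bool) :
    bernoulliWeight p (Function.update x e b) =
      (if b then p e else 1 - p e) * ∏ j ∈ Finset.univ.erase e, if x j then p j else 1 - p j := by
  rw [bernoulliWeight, ← Finset.mul_prod_erase _ _ (Finset.mem_univ e)]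
  congr 1
  · simp
  · refine Finset.prod_congr rfl fun j hj => ?_
    rw [Function.update_of_ne (Finset.ne_of_mem_erase hj)]

/-- Flipping the coordinate `e` is an involution of the configurations that swaps the factors `p e`
and `1 - p e` of the weight and fixes `h`. -/
theorem bernoulliMean_flip (p : ι → ℝ) (e : ι) (h : (ι → Bool) → ℝ)
    (hh : ∀ x b, h (Function.update x e b) = h x) :
    p e * bernoulliMean p (fun x => (1 - ind (x e)) * h x) =
      (1 - p e) * bernoulliMean p (fun x => ind (x e) * h x) := by
  have hinv : Function.Involutive fun x : ι → Bool => Function.update x e (!x e) := by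
    intro x; simp
  rw [← bernoulliMean_const_mul, ← bernoulliMean_const_mul]
  unfold bernoulliMean
  rw [← Equiv.sum_comp hinv.toPerm]
  refine Finset.sum_congr rfl fun x _ => ?_
  have hx := bernoulliWeight_update p x e (x e)
  rw [Function.update_eq_self] at hx
  simp only [Function.Involutive.coe_toPerm, hh, bernoulliWeight_update, hx, Function.update_self]
  cases x e <;> (simp [ind]; try ring)

theorem bernoulliMean_split (p : ι → ℝ) (e : ι) (h : (ι → Bool) → ℝ) :
    bernoulliMean p h = bernoulliMean p (fun x => ind (x e) * h x) +
      bernoulliMean p (fun x => (1 - ind (x e)) * h x) := by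
  rw [← bernoulliMean_add]; congr 1; ext x; ring

theorem bernoulliMean_ind_mul (p : ι → ℝ) (e : ι) (g : (ι → Bool) → ℝ) :
    bernoulliMean p (fun x => ind (x e) * g x) =
      p e * bernoulliMean p (fun x => g (Function.update x e true)) := by
  have h1 : (fun x : ι → Bool => ind (x e) * g x) =
      fun x => ind (x e) * g (Function.update x e true) := by
    ext x
    rcases hx : x e with _ | _
    · simp [ind]
    · rw [← hx, Function.update_eq_self]
  have h2 := bernoulliMean_flip p e (fun x => g (Function.update x e true)) (by simp)
  have h3 := bernoulliMean_split p e (fun x => g (Function.update x e true))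
  rw [h1, h3, mul_add, h2]; ring

theorem bernoulliMean_one_sub_ind_mul (p : ι → ℝ) (e : ι) (g : (ι → Bool) → ℝ) :
    bernoulliMean p (fun x => (1 - ind (x e)) * g x) =
      (1 - p e) * bernoulliMean p (fun x => g (Function.update x e false)) := by
  have h1 : (fun x : ι → Bool => (1 - ind (x e)) * g x) =
      fun x => (1 - ind (x e)) * g (Function.update x e false) := by
    ext x
    rcases hx : x e with _ | _
    · rw [← hx, Function.update_eq_self]
    · simp [ind]
  have h2 := bernoulliMean_flip p e (fun x => g (Function.update x e false)) (by simp)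
  have h3 := bernoulliMean_split p e (fun x => g (Function.update x e false))
  rw [h1, h3, mul_add, ← h2]; ring

/-- Integration by parts for a centred Bernoulli variable. -/
theorem bernoulliMean_centered_mul_le {p : ι → ℝ} (hp : ∀ e, p e ∈ Set.Icc (0 : ℝ) 1) (e : ι)
    {c : ℝ} (hc : 0 ≤ c) (g G : (ι → Bool) → ℝ) (hG : ∀ x, 0 ≤ G x)
    (h : ∀ x, g (Function.update x e true) - g (Function.update x e false) ≤
      c * (G (Function.update x e true) + G (Function.update x e false))) :
    bernoulliMean p (fun x => (ind (x e) - p e) * g x) ≤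
      c * bernoulliMean p (fun x => (ind (x e) + p e) * G x) := by
  obtain ⟨h0, h1⟩ := hp e
  have key : ∀ (g : (ι → Bool) → ℝ) (s : ℝ),
      bernoulliMean p (fun x => (1 - p e) * (ind (x e) * g x) + s * ((1 - ind (x e)) * g x)) =
      (1 - p e) * (p e * bernoulliMean p (fun x => g (Function.update x e true))) +
      s * ((1 - p e) * bernoulliMean p (fun x => g (Function.update x e false))) := by
    intro g s
    rw [bernoulliMean_add, bernoulliMean_const_mul, bernoulliMean_const_mul,
      bernoulliMean_ind_mul, bernoulliMean_one_sub_ind_mul]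
  have e1 := key g (-p e)
  have e2 := key G (p e)
  have e3 : (fun x : ι → Bool => (ind (x e) - p e) * g x) =
      fun x => (1 - p e) * (ind (x e) * g x) + -p e * ((1 - ind (x e)) * g x) := by
    ext x; ring
  -- The exact weight `(1 - p) X + p (1 - X)` is at most `X + p`, a form that later sums over edges
  -- to a realized plus an expected degree.
  have e4 : bernoulliMean p (fun x => (1 - p e) * (ind (x e) * G x) +
      p e * ((1 - ind (x e)) * G x)) ≤ bernoulliMean p (fun x => (ind (x e) + p e) * G x) := by
    refine bernoulliMean_mono hp fun x => ?_
    have : 0 ≤ ind (x e) := by unfold ind; split_ifs <;> norm_num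
    have := mul_nonneg (mul_nonneg h0 this) (hG x)
    nlinarith
  have e5 := bernoulliMean_mono hp h
  rw [bernoulliMean_const_mul, bernoulliMean_add] at e5
  have e6 : bernoulliMean p (fun x => g (Function.update x e true) -
      g (Function.update x e false)) = bernoulliMean p (fun x => g (Function.update x e true)) -
      bernoulliMean p (fun x => g (Function.update x e false)) := by
    simp [bernoulliMean, mul_sub, Finset.sum_sub_distrib]
  rw [e6] at e5
  have e7 := mul_le_mul_of_nonneg_left e5 (mul_nonneg h0 (sub_nonneg.2 h1))
  rw [e3, e1]
  calc _ ≤ c * _ := by rw [e2]; linarith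
    _ ≤ _ := mul_le_mul_of_nonneg_left e4 hc

/-- By independence the mean factors. Each factor is controlled by `exp θ ≤ 1 + 2θ` on `[0, 1]` and
then `1 + t ≤ exp t`. -/
theorem bernoulliMean_exp_le {p : ι → ℝ} (hp : ∀ e, p e ∈ Set.Icc (0 : ℝ) 1) {θ : ι → ℝ}
    (hθ : ∀ e, θ e ∈ Set.Icc (0 : ℝ) 1) :
    bernoulliMean p (fun x => Real.exp (∑ e, θ e * ind (x e))) ≤
      Real.exp (2 * ∑ e, θ e * p e) := by
  simp only [Real.exp_sum, Finset.mul_sum]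
  rw [bernoulliMean_prod p (fun e b => Real.exp (θ e * ind b))]
  refine Finset.prod_le_prod (fun e _ => ?_) fun e _ => ?_
  · have := (hp e).1
    have := (hp e).2
    have : 0 ≤ 1 - p e := by linarith
    positivity
  · obtain ⟨h0, h1⟩ := hp e
    obtain ⟨t0, t1⟩ := hθ e
    simp only [ind, if_true, mul_one, Bool.false_eq_true, if_false, mul_zero, Real.exp_zero]
    have a1 : Real.exp (θ e) ≤ 1 + 2 * θ e := by
      have := Real.abs_exp_sub_one_sub_id_le (x := θ e) (by rw [abs_of_nonneg t0]; exact t1)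
      have := (abs_le.1 this).2
      nlinarith
    have a2 := Real.add_one_le_exp (2 * (θ e * p e))
    nlinarith

/-- From `t ^ k ≤ k! exp t ≤ k ^ k exp t` at `t = k N / m` one gets `N ^ k ≤ m ^ k exp (k N / m)`.
The condition `k ≤ m` keeps the exponents in the range of `bernoulliMean_exp_le`. The `3` is one
unit from the deterministic part of `N` and two from the random part. -/
theorem bernoulliMean_sum_pow_le {p : ι → ℝ} (hp : ∀ e, p e ∈ Set.Icc (0 : ℝ) 1) {c : ι → ℝ}
    (hc : ∀ e, c e ∈ Set.Icc (0 : ℝ) 1) {m : ℝ} {k : ℕ} (hm : 0 < m) (hk : (k : ℝ) ≤ m)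
    (hcp : ∑ e, c e * p e ≤ m) :
    bernoulliMean p (fun x => (∑ e, c e * (ind (x e) + p e)) ^ k) ≤ (Real.exp 3 * m) ^ k := by
  have hind : ∀ b, 0 ≤ ind b := fun b => by unfold ind; split_ifs <;> norm_num
  set μ := ∑ e, c e * p e with hμ
  have hpt : ∀ x : ι → Bool, (∑ e, c e * (ind (x e) + p e)) ^ k ≤
      m ^ k * Real.exp (k / m * μ) * Real.exp (∑ e, (k / m * c e) * ind (x e)) := by
    intro x
    have hN : 0 ≤ ∑ e, c e * (ind (x e) + p e) :=
      Finset.sum_nonneg fun e _ => mul_nonneg (hc e).1 (add_nonneg (hind _) (hp e).1)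
    have hs : (k / m) * ∑ e, c e * (ind (x e) + p e) =
        k / m * μ + ∑ e, (k / m * c e) * ind (x e) := by
      rw [hμ, Finset.mul_sum, Finset.mul_sum, ← Finset.sum_add_distrib]
      exact Finset.sum_congr rfl fun e _ => by ring
    rw [mul_assoc, ← Real.exp_add, ← hs]
    set N := ∑ e, c e * (ind (x e) + p e)
    rcases Nat.eq_zero_or_pos k with rfl | hk0
    · simp
    have hk0' : (0 : ℝ) < k := by exact_mod_cast hk0
    have h1 := Real.pow_div_factorial_le_exp (k / m * N) (by positivity) k
    have h2 : ((Nat.factorial k : ℕ) : ℝ) ≤ (k : ℝ) ^ k := by exact_mod_cast Nat.factorial_le_pow k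
    rw [div_le_iff₀ (by positivity)] at h1
    have h3 : (k / m * N) ^ k ≤ Real.exp (k / m * N) * (k : ℝ) ^ k :=
      h1.trans (mul_le_mul_of_nonneg_left h2 (Real.exp_pos _).le)
    have h4 : (k / m * N) ^ k = (k : ℝ) ^ k * (N ^ k / m ^ k) := by
      rw [mul_pow, div_pow]; ring
    rw [h4, mul_comm (Real.exp _)] at h3
    have h5 := le_of_mul_le_mul_left h3 (by positivity)
    rw [div_le_iff₀ (by positivity)] at h5
    linarith
  have hkm : (k : ℝ) / m ≤ 1 := (div_le_one hm).2 hk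
  have hkm0 : 0 ≤ (k : ℝ) / m := by positivity
  calc _ ≤ _ := bernoulliMean_mono hp hpt
    _ = m ^ k * Real.exp (k / m * μ) * _ := bernoulliMean_const_mul _ _ _
    _ ≤ m ^ k * Real.exp (k / m * μ) * Real.exp (2 * ∑ e, (k / m * c e) * p e) := by
        refine mul_le_mul_of_nonneg_left (bernoulliMean_exp_le hp fun e => ?_) (by positivity)
        exact ⟨mul_nonneg hkm0 (hc e).1, mul_le_one₀ hkm (hc e).1 (hc e).2⟩
    _ = m ^ k * Real.exp (3 * (k / m * μ)) := by
        rw [mul_assoc, ← Real.exp_add]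
        congr 2
        rw [hμ]
        simp only [Finset.mul_sum]
        rw [← Finset.sum_add_distrib]
        exact Finset.sum_congr rfl fun e _ => by ring
    _ ≤ m ^ k * Real.exp (k * 3) := by
        gcongr ?_ * Real.exp ?_
        have : k / m * μ ≤ k / m * m := by gcongr
        rw [div_mul_cancel₀ _ hm.ne'] at this
        linarith
    _ = _ := by rw [Real.exp_nat_mul, mul_pow]; ring

/-- Markov's inequality. -/
theorem bernoulliMean_markov {p : ι → ℝ} (hp : ∀ e, p e ∈ Set.Icc (0 : ℝ) 1)
    (f : (ι → Bool) → ℝ) (hf : ∀ x, 0 ≤ f x) {t : ℝ} (ht : 0 < t) :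
    ∑ x with t ≤ f x, bernoulliWeight p x ≤ bernoulliMean p f / t := by
  rw [le_div_iff₀ ht, Finset.sum_mul, bernoulliMean]
  calc _ ≤ ∑ x with t ≤ f x, bernoulliWeight p x * f x := by
        refine Finset.sum_le_sum fun x hx => ?_
        exact mul_le_mul_of_nonneg_left (Finset.mem_filter.1 hx).2 (bernoulliWeight_nonneg hp x)
    _ ≤ _ := Finset.sum_le_sum_of_subset_of_nonneg (Finset.filter_subset _ _)
        fun x _ _ => mul_nonneg (bernoulliWeight_nonneg hp x) (hf x)

end Bernoulli

/-- A form of Young's inequality with a free parameter. -/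
theorem mul_pow_le_add {d y κ : ℝ} (hd : 0 ≤ d) (hy : 0 ≤ y) (hκ : 0 < κ) (j : ℕ) :
    d * y ^ j ≤ κ ^ j * d ^ (j + 1) + y ^ (j + 1) / κ := by
  rcases le_total y (κ * d) with h | h
  · have h1 : d * y ^ j ≤ d * (κ * d) ^ j := by gcongr
    have h2 : 0 ≤ y ^ (j + 1) / κ := by positivity
    calc _ ≤ d * (κ * d) ^ j := h1
      _ = κ ^ j * d ^ (j + 1) := by rw [mul_pow, pow_succ]; ring
      _ ≤ _ := by linarith
  · have h1 : d ≤ y / κ := by rw [le_div_iff₀ hκ]; linarith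
    have h2 : 0 ≤ κ ^ j * d ^ (j + 1) := by positivity
    calc _ ≤ y / κ * y ^ j := by gcongr
      _ = y ^ (j + 1) / κ := by rw [pow_succ]; ring
      _ ≤ _ := by linarith

/-! ### Trace inequalities for real symmetric matrices. -/

section Trace

variable {n : ℕ}

/-- Orthogonal diagonalization of a real symmetric matrix. -/
theorem exists_orthogonal_diagonalization {M : Matrix (Fin n) (Fin n) ℝ} (hM : M.IsSymm) :
    ∃ (U : Matrix (Fin n) (Fin n) ℝ) (l : Fin n → ℝ), Uᵀ * U = 1 ∧ U * Uᵀ = 1 ∧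
      ∀ k : ℕ, M ^ k = U * Matrix.diagonal (fun i => l i ^ k) * Uᵀ := by
  have hH : M.IsHermitian := (Matrix.conjTranspose_eq_transpose_of_trivial M).trans hM
  let U : Matrix (Fin n) (Fin n) ℝ := hH.eigenvectorUnitary
  have h1 : Uᵀ * U = 1 := by
    have := Unitary.coe_star_mul_self hH.eigenvectorUnitary
    rwa [Matrix.star_eq_conjTranspose, Matrix.conjTranspose_eq_transpose_of_trivial] at this
  have h2 : U * Uᵀ = 1 := mul_eq_one_comm.1 h1
  have h3 : M = U * Matrix.diagonal hH.eigenvalues * Uᵀ := by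
    have := hH.spectral_theorem
    rw [Unitary.conjStarAlgAut_apply, Matrix.star_eq_conjTranspose,
      Matrix.conjTranspose_eq_transpose_of_trivial] at this
    exact this
  refine ⟨U, hH.eigenvalues, h1, h2, fun k => ?_⟩
  induction k with
  | zero => simp [h2]
  | succ k ih =>
    rw [pow_succ, ih]
    nth_rewrite 2 [h3]
    calc _ = U * Matrix.diagonal (fun i => hH.eigenvalues i ^ k) * (Uᵀ * U) *
        Matrix.diagonal hH.eigenvalues * Uᵀ := by simp only [Matrix.mul_assoc]
      _ = _ := by
        rw [h1, Matrix.mul_one, Matrix.mul_assoc U, Matrix.diagonal_mul_diagonal]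
        simp only [pow_succ]

/-- The Frobenius inner product is invariant under orthogonal maps on both sides. Allowing two
different bases makes it possible to diagonalize one matrix on the left and another on the right. -/
theorem trace_mul_transpose_eq_sum {U V : Matrix (Fin n) (Fin n) ℝ} (hU : U * Uᵀ = 1)
    (hV : V * Vᵀ = 1) (X D : Matrix (Fin n) (Fin n) ℝ) :
    (X * Dᵀ).trace = ∑ i, ∑ j, (Uᵀ * X * V) i j * (Uᵀ * D * V) i j := by
  have h : (X * Dᵀ).trace = ((Uᵀ * X * V) * (Uᵀ * D * V)ᵀ).trace := by
    simp only [Matrix.transpose_mul, Matrix.transpose_transpose]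
    calc (X * Dᵀ).trace = ((U * Uᵀ) * (X * (V * Vᵀ) * Dᵀ)).trace := by
          rw [hU, hV, Matrix.mul_one, Matrix.one_mul]
      _ = (U * (Uᵀ * X * V * (Vᵀ * Dᵀ))).trace := by simp only [Matrix.mul_assoc]
      _ = _ := by rw [Matrix.trace_mul_comm]; simp only [Matrix.mul_assoc]
  rw [h]
  rw [Matrix.trace]
  exact Finset.sum_congr rfl fun i _ => by rw [Matrix.diag_apply, Matrix.mul_apply]; rfl

/-- After factoring out `x - y`, each of the `2k + 1` monomials left has degree `2k`, hence is at
most the larger of `|x| ^ (2k)` and `|y| ^ (2k)`. -/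
theorem sub_mul_pow_sub_le (x y : ℝ) (k : ℕ) :
    (x - y) * (x ^ (2 * k + 1) - y ^ (2 * k + 1)) ≤
      (2 * k + 1) * ((x - y) ^ 2 * (x ^ (2 * k) + y ^ (2 * k))) := by
  have h := (Commute.all x y).geom_sum₂_mul (2 * k + 1)
  rw [← h]
  have h2 : ∑ i ∈ Finset.range (2 * k + 1), x ^ i * y ^ (2 * k + 1 - 1 - i) ≤
      (2 * k + 1) * (x ^ (2 * k) + y ^ (2 * k)) := by
    calc _ ≤ ∑ i ∈ Finset.range (2 * k + 1), (x ^ (2 * k) + y ^ (2 * k)) := by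
          refine Finset.sum_le_sum fun i hi => ?_
          have hi' : i + (2 * k + 1 - 1 - i) = 2 * k := by
            have := Finset.mem_range.1 hi; omega
          have e1 : x ^ (2 * k) = |x| ^ (2 * k) := (Even.pow_abs (even_two_mul k) x).symm
          have e2 : y ^ (2 * k) = |y| ^ (2 * k) := (Even.pow_abs (even_two_mul k) y).symm
          calc _ ≤ |x ^ i * y ^ (2 * k + 1 - 1 - i)| := le_abs_self _
            _ = |x| ^ i * |y| ^ (2 * k + 1 - 1 - i) := by rw [abs_mul, abs_pow, abs_pow]
            _ ≤ _ := by
              rw [e1, e2]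
              rcases le_total |x| |y| with hxy | hxy
              · have : |x| ^ i * |y| ^ (2 * k + 1 - 1 - i) ≤ |y| ^ (2 * k) := by
                  conv_rhs => rw [← hi', pow_add |y|]
                  gcongr
                have : 0 ≤ |x| ^ (2 * k) := by positivity
                linarith
              · have : |x| ^ i * |y| ^ (2 * k + 1 - 1 - i) ≤ |x| ^ (2 * k) := by
                  conv_rhs => rw [← hi', pow_add |x|]
                  gcongr
                have : 0 ≤ |y| ^ (2 * k) := by positivity
                linarith
      _ = _ := by rw [Finset.sum_const, Finset.card_range, nsmul_eq_mul]; push_cast; ring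
  calc _ = (x - y) ^ 2 * ∑ i ∈ Finset.range (2 * k + 1), x ^ i * y ^ (2 * k + 1 - 1 - i) := by ring
    _ ≤ (x - y) ^ 2 * ((2 * k + 1) * (x ^ (2 * k) + y ^ (2 * k))) :=
        mul_le_mul_of_nonneg_left h2 (sq_nonneg _)
    _ = _ := by ring

/-- A mean value inequality for odd trace powers of symmetric matrices. -/
theorem trace_mul_pow_sub_pow_le {W Y : Matrix (Fin n) (Fin n) ℝ} (hW : W.IsSymm) (hY : Y.IsSymm)
    (k : ℕ) :
    ((W - Y) * W ^ (2 * k + 1)).trace - ((W - Y) * Y ^ (2 * k + 1)).trace ≤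
      (2 * k + 1) * (((W - Y) * (W - Y) * W ^ (2 * k)).trace +
        ((W - Y) * (W - Y) * Y ^ (2 * k)).trace) := by
  obtain ⟨U, l, U1, U2, hl⟩ := exists_orthogonal_diagonalization hW
  obtain ⟨V, m, V1, V2, hm⟩ := exists_orthogonal_diagonalization hY
  have eW : ∀ (q : ℕ) (X : Matrix (Fin n) (Fin n) ℝ) (i j : Fin n),
      (Uᵀ * (W ^ q * X) * V) i j = l i ^ q * (Uᵀ * X * V) i j := by
    intro q X i j
    have : Uᵀ * (W ^ q * X) * V = Matrix.diagonal (fun i => l i ^ q) * (Uᵀ * X * V) := by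
      rw [hl]
      calc _ = (Uᵀ * U) * Matrix.diagonal (fun i => l i ^ q) * (Uᵀ * X * V) := by
            simp only [Matrix.mul_assoc]
        _ = _ := by rw [U1, Matrix.one_mul]
    rw [this, Matrix.diagonal_mul]
  have eY : ∀ (q : ℕ) (X : Matrix (Fin n) (Fin n) ℝ) (i j : Fin n),
      (Uᵀ * (X * Y ^ q) * V) i j = (Uᵀ * X * V) i j * m j ^ q := by
    intro q X i j
    have : Uᵀ * (X * Y ^ q) * V = (Uᵀ * X * V) * Matrix.diagonal (fun i => m i ^ q) := by
      rw [hm]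
      calc _ = (Uᵀ * X * V) * Matrix.diagonal (fun i => m i ^ q) * (Vᵀ * V) := by
            simp only [Matrix.mul_assoc]
        _ = _ := by rw [V1, Matrix.mul_one]
    rw [this, Matrix.mul_diagonal]
  have hWY : (W - Y)ᵀ = W - Y := by rw [Matrix.transpose_sub, hW, hY]
  -- In the mixed eigenbases, `W` on the left and `Y` on the right, differences of powers become
  -- scalar differences even though the matrices need not commute. The claim then reduces to
  -- `sub_mul_pow_sub_le` with weights `(Uᵀ * V) i j ^ 2`.
  have eD : ∀ (q : ℕ) (i j : Fin n),
      (Uᵀ * (W ^ q - Y ^ q) * V) i j = (l i ^ q - m j ^ q) * (Uᵀ * V) i j := by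
    intro q i j
    have h1 := eW q 1 i j
    have h2 := eY q 1 i j
    simp only [Matrix.mul_one, Matrix.one_mul] at h1 h2
    rw [Matrix.mul_sub, Matrix.sub_mul, Matrix.sub_apply, h1, h2]; ring
  have eB : ∀ i j, (Uᵀ * (W - Y) * V) i j = (l i - m j) * (Uᵀ * V) i j := by
    intro i j; simpa using eD 1 i j
  have t1 : ((W - Y) * W ^ (2 * k + 1)).trace - ((W - Y) * Y ^ (2 * k + 1)).trace =
      ∑ i, ∑ j, ((l i - m j) * (l i ^ (2 * k + 1) - m j ^ (2 * k + 1))) * (Uᵀ * V) i j ^ 2 := by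
    rw [← Matrix.trace_sub, ← Matrix.mul_sub]
    have hs : (W ^ (2 * k + 1) - Y ^ (2 * k + 1))ᵀ = W ^ (2 * k + 1) - Y ^ (2 * k + 1) := by
      rw [Matrix.transpose_sub, Matrix.transpose_pow, Matrix.transpose_pow, hW, hY]
    rw [← hs, trace_mul_transpose_eq_sum U2 V2]
    simp only [eD, eB]
    exact Finset.sum_congr rfl fun i _ => Finset.sum_congr rfl fun j _ => by ring
  have t2 : ((W - Y) * (W - Y) * W ^ (2 * k)).trace =
      ∑ i, ∑ j, l i ^ (2 * k) * ((l i - m j) * (Uᵀ * V) i j) ^ 2 := by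
    rw [Matrix.trace_mul_comm, ← Matrix.mul_assoc]
    nth_rewrite 2 [← hWY]
    rw [trace_mul_transpose_eq_sum U2 V2]
    simp only [eW, eB]
    exact Finset.sum_congr rfl fun i _ => Finset.sum_congr rfl fun j _ => by ring
  have t3 : ((W - Y) * (W - Y) * Y ^ (2 * k)).trace =
      ∑ i, ∑ j, m j ^ (2 * k) * ((l i - m j) * (Uᵀ * V) i j) ^ 2 := by
    rw [Matrix.mul_assoc, Matrix.trace_mul_comm]
    nth_rewrite 2 [← hWY]
    rw [trace_mul_transpose_eq_sum U2 V2]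
    simp only [eY, eB]
    exact Finset.sum_congr rfl fun i _ => Finset.sum_congr rfl fun j _ => by ring
  rw [t1, t2, t3, ← Finset.sum_add_distrib, Finset.mul_sum]
  refine Finset.sum_le_sum fun i _ => ?_
  rw [← Finset.sum_add_distrib, Finset.mul_sum]
  refine Finset.sum_le_sum fun j _ => ?_
  have := mul_le_mul_of_nonneg_right (sub_mul_pow_sub_le (l i) (m j) k)
    (sq_nonneg ((Uᵀ * V) i j))
  calc _ ≤ _ := this
    _ = _ := by ring

theorem diag_even_pow_nonneg {M : Matrix (Fin n) (Fin n) ℝ} (hM : M.IsSymm) (k : ℕ) (i : Fin n) :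
    0 ≤ (M ^ (2 * k)) i i := by
  have h : M ^ (2 * k) = M ^ k * (M ^ k)ᵀ := by
    rw [Matrix.transpose_pow, hM, two_mul, pow_add]
  rw [h, Matrix.mul_apply]
  exact Finset.sum_nonneg fun j _ => by rw [Matrix.transpose_apply]; exact mul_self_nonneg _

/-- The diagonal entry is a moment of the squared eigenvalues under the probability weights `U i j ^
2`, so the scalar inequality `mul_pow_le_add` can be averaged. -/
theorem mul_diag_even_pow_le {M : Matrix (Fin n) (Fin n) ℝ} (hM : M.IsSymm) (k : ℕ) (i : Fin n)
    {d κ : ℝ} (hd : 0 ≤ d) (hκ : 0 < κ) :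
    d * (M ^ (2 * k)) i i ≤ κ ^ k * d ^ (k + 1) + (M ^ (2 * (k + 1))) i i / κ := by
  obtain ⟨U, l, U1, U2, hl⟩ := exists_orthogonal_diagonalization hM
  have e : ∀ q : ℕ, (M ^ (2 * q)) i i = ∑ j, U i j ^ 2 * (l j ^ 2) ^ q := by
    intro q
    rw [hl, Matrix.mul_apply]
    refine Finset.sum_congr rfl fun j _ => ?_
    rw [Matrix.mul_diagonal, Matrix.transpose_apply, pow_mul]; ring
  have e1 : ∑ j, U i j ^ 2 = 1 := by
    have := congrFun (congrFun U2 i) i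
    rw [Matrix.mul_apply, Matrix.one_apply_eq] at this
    rw [← this]
    exact Finset.sum_congr rfl fun j _ => by rw [Matrix.transpose_apply, sq]
  rw [e, e]
  calc d * ∑ j, U i j ^ 2 * (l j ^ 2) ^ k = ∑ j, U i j ^ 2 * (d * (l j ^ 2) ^ k) := by
        rw [Finset.mul_sum]; exact Finset.sum_congr rfl fun j _ => by ring
    _ ≤ ∑ j, U i j ^ 2 * (κ ^ k * d ^ (k + 1) + (l j ^ 2) ^ (k + 1) / κ) :=
        Finset.sum_le_sum fun j _ => mul_le_mul_of_nonneg_left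
          (mul_pow_le_add hd (sq_nonneg _) hκ k) (sq_nonneg _)
    _ = (∑ j, U i j ^ 2) * (κ ^ k * d ^ (k + 1)) +
        (∑ j, U i j ^ 2 * (l j ^ 2) ^ (k + 1)) / κ := by
        rw [Finset.sum_mul, Finset.sum_div, ← Finset.sum_add_distrib]
        exact Finset.sum_congr rfl fun j _ => by ring
    _ = _ := by rw [e1, one_mul]

/-- A trace bound on an even power bounds the quadratic form. -/
theorem abs_dotProduct_mulVec_le_of_trace_le {M : Matrix (Fin n) (Fin n) ℝ} (hM : M.IsSymm)
    {k : ℕ} (hk : k ≠ 0) {t : ℝ} (ht : 0 ≤ t) (h : (M ^ (2 * k)).trace ≤ (t ^ 2) ^ k)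
    (x : Fin n → ℝ) : |x ⬝ᵥ (M *ᵥ x)| ≤ t * (x ⬝ᵥ x) := by
  obtain ⟨U, l, U1, U2, hl⟩ := exists_orthogonal_diagonalization hM
  have htr : (M ^ (2 * k)).trace = ∑ i, (l i ^ 2) ^ k := by
    rw [hl, Matrix.mul_assoc, Matrix.trace_mul_comm, Matrix.mul_assoc, U1, Matrix.mul_one,
      Matrix.trace_diagonal]
    simp only [pow_mul]
  have hlt : ∀ i, |l i| ≤ t := by
    intro i
    have h1 : (l i ^ 2) ^ k ≤ (t ^ 2) ^ k :=
      (Finset.single_le_sum (f := fun i => (l i ^ 2) ^ k) (fun i _ => by positivity)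
        (Finset.mem_univ i)).trans (htr ▸ h)
    have h2 := le_of_pow_le_pow_left₀ hk (by positivity) h1
    exact abs_le_of_sq_le_sq h2 ht
  have hq : x ⬝ᵥ (M *ᵥ x) = ∑ i, l i * (Uᵀ *ᵥ x) i ^ 2 := by
    have := hl 1
    simp only [pow_one] at this
    rw [this, ← Matrix.mulVec_mulVec, ← Matrix.mulVec_mulVec, Matrix.dotProduct_mulVec,
      ← Matrix.mulVec_transpose, dotProduct]
    exact Finset.sum_congr rfl fun i _ => by rw [Matrix.mulVec_diagonal]; ring
  have hn : x ⬝ᵥ x = ∑ i, (Uᵀ *ᵥ x) i ^ 2 := by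
    have : x = U *ᵥ (Uᵀ *ᵥ x) := by rw [Matrix.mulVec_mulVec, U2, Matrix.one_mulVec]
    nth_rewrite 2 [this]
    rw [Matrix.dotProduct_mulVec, ← Matrix.mulVec_transpose, dotProduct]
    exact Finset.sum_congr rfl fun i _ => by ring
  rw [hq, hn, Finset.mul_sum]
  refine (Finset.abs_sum_le_sum_abs _ _).trans (Finset.sum_le_sum fun i _ => ?_)
  rw [abs_mul, abs_of_nonneg (sq_nonneg ((Uᵀ *ᵥ x) i))]
  exact mul_le_mul_of_nonneg_right (hlt i) (sq_nonneg _)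

end Trace

/-! ### Unordered pairs and single-edge matrices. -/

section Edges

variable {n : ℕ}

/-- The unordered pairs of vertices, represented by ordered pairs. -/
abbrev Edge (n : ℕ) : Type := {e : Fin n × Fin n // e.1 ≤ e.2}

/-- The unordered pair `{i, j}`. -/
def edgeKey (i j : Fin n) : Edge n :=
  if h : i ≤ j then ⟨(i, j), h⟩ else ⟨(j, i), le_of_not_ge h⟩

theorem edgeKey_comm (i j : Fin n) : edgeKey i j = edgeKey j i := by
  unfold edgeKey
  split_ifs with h1 h2 h2
  · obtain rfl := le_antisymm h1 h2; rfl
  · rfl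
  · rfl
  · exact absurd (le_of_not_ge h1) h2

theorem edgeKey_cases {i j : Fin n} {e : Edge n} (h : edgeKey i j = e) :
    (i, j) = e.1 ∨ (i, j) = (e.1.2, e.1.1) := by
  subst h
  unfold edgeKey
  split_ifs <;> simp

theorem edgeKey_self (e : Edge n) : edgeKey e.1.1 e.1.2 = e := by
  simp [edgeKey, e.2]

theorem edgeKey_injective (i : Fin n) : Function.Injective (edgeKey i) := by
  intro j k h
  unfold edgeKey at h
  split_ifs at h <;> simp only [Subtype.mk.injEq, Prod.mk.injEq] at h <;> grind

/-- The symmetric matrix whose entry at `(i, j)` is the value of `y` at the pair `{i, j}`. -/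
def symMatrix (y : Edge n → ℝ) : Matrix (Fin n) (Fin n) ℝ := Matrix.of fun i j => y (edgeKey i j)

theorem symMatrix_isSymm (y : Edge n → ℝ) : (symMatrix y).IsSymm := by
  ext i j; simp [symMatrix, edgeKey_comm]

/-- The adjacency matrix of the graph with the single edge `e`. -/
def edgeMatrix (e : Edge n) : Matrix (Fin n) (Fin n) ℝ := symMatrix (Pi.single e 1)

theorem edgeMatrix_apply (e : Edge n) (i j : Fin n) :
    edgeMatrix e i j = if edgeKey i j = e then 1 else 0 := by
  simp [edgeMatrix, symMatrix, Pi.single_apply]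

theorem symMatrix_eq_sum (y : Edge n → ℝ) : symMatrix y = ∑ e, y e • edgeMatrix e := by
  ext i j
  simp [Matrix.sum_apply, edgeMatrix_apply, symMatrix]

theorem degreeVector_symMatrix_eq_sum (y : Edge n → ℝ) :
    degreeVector (symMatrix y) = ∑ e, y e • degreeVector (edgeMatrix e) := by
  ext i
  simp only [degreeVector, symMatrix_eq_sum y, Matrix.sum_apply, Matrix.smul_apply, smul_eq_mul,
    WithLp.ofLp_sum, Finset.sum_apply, PiLp.smul_apply, Finset.mul_sum]
  exact Finset.sum_comm

theorem sum_edgeMatrix_mem (e : Edge n) (i : Fin n) :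
    ∑ j, edgeMatrix e i j ∈ Set.Icc (0 : ℝ) 1 := by
  simp only [edgeMatrix_apply, Finset.sum_boole]
  refine ⟨by positivity, ?_⟩
  norm_cast
  refine Finset.card_le_one.2 fun a ha b hb => edgeKey_injective i ?_
  rw [(Finset.mem_filter.1 ha).2, (Finset.mem_filter.1 hb).2]

theorem sum_sum_edgeMatrix_le (e : Edge n) : ∑ i, ∑ j, edgeMatrix e i j ≤ 2 := by
  rw [← Finset.sum_product' (f := fun i j => edgeMatrix e i j)]
  simp only [edgeMatrix_apply, Finset.sum_boole]
  have : (Finset.univ ×ˢ Finset.univ).filter (fun x : Fin n × Fin n => edgeKey x.1 x.2 = e) ⊆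
      {e.1, (e.1.2, e.1.1)} := by
    intro x hx
    have := edgeKey_cases (Finset.mem_filter.1 hx).2
    simpa using this
  exact_mod_cast (Finset.card_le_card this).trans Finset.card_le_two

theorem norm_sq_degreeVector_edgeMatrix_le (e : Edge n) :
    ‖degreeVector (edgeMatrix e)‖ ^ 2 ≤ 2 := by
  rw [EuclideanSpace.norm_sq_eq]
  refine le_trans (Finset.sum_le_sum fun i _ => ?_) (sum_sum_edgeMatrix_le e)
  obtain ⟨h0, h1⟩ := sum_edgeMatrix_mem e i
  simp only [degreeVector, Real.norm_eq_abs, sq_abs]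
  nlinarith

/-- A single edge is a matching, so a walk of length two along it returns to its start. -/
theorem edgeMatrix_mul_self (e : Edge n) :
    edgeMatrix e * edgeMatrix e = Matrix.diagonal fun i => ∑ j, edgeMatrix e i j := by
  ext i k
  rw [Matrix.mul_apply, Matrix.diagonal_apply]
  split_ifs with h
  · subst h
    refine Finset.sum_congr rfl fun j _ => ?_
    rw [edgeMatrix_apply, edgeMatrix_apply, edgeKey_comm j i]
    split_ifs <;> simp
  · refine Finset.sum_eq_zero fun j _ => ?_
    rw [edgeMatrix_apply, edgeMatrix_apply, mul_ite, mul_one, mul_zero]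
    split_ifs with h1 h2
    · exact absurd (edgeKey_injective j (by rw [edgeKey_comm j i, h1, h2])) h
    all_goals rfl

theorem sum_mul_edgeMatrix (y : Edge n → ℝ) (i j : Fin n) :
    ∑ e, y e * edgeMatrix e i j = y (edgeKey i j) := by
  simp [edgeMatrix_apply]

theorem sum_edgeMatrix_mul_eq (y : Edge n → ℝ) (i : Fin n) :
    ∑ e, (∑ j, edgeMatrix e i j) * y e = ∑ j, y (edgeKey i j) := by
  simp only [Finset.sum_mul]
  rw [Finset.sum_comm]
  refine Finset.sum_congr rfl fun j _ => ?_
  rw [← sum_mul_edgeMatrix y i j]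
  exact Finset.sum_congr rfl fun e _ => mul_comm _ _

/-- This turns the sum over edges produced by integration by parts into weighted degrees against
diagonal entries. -/
theorem sum_mul_trace_edgeMatrix_sq (y : Edge n → ℝ) (M : Matrix (Fin n) (Fin n) ℝ) :
    ∑ e, y e * (edgeMatrix e * edgeMatrix e * M).trace =
      ∑ i, (∑ j, y (edgeKey i j)) * M i i := by
  simp only [edgeMatrix_mul_self, Matrix.trace, Matrix.diag_apply, Matrix.diagonal_mul,
    ← sum_edgeMatrix_mul_eq, Finset.mul_sum, Finset.sum_mul]
  rw [Finset.sum_comm]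
  refine Finset.sum_congr rfl fun i _ => Finset.sum_congr rfl fun e _ => ?_
  exact Finset.sum_congr rfl fun j _ => by ring

theorem sum_edge_le_sum_sum {y : Edge n → ℝ} (hy : ∀ e, 0 ≤ y e) :
    ∑ e, y e ≤ ∑ i, ∑ j, y (edgeKey i j) := by
  rw [← Finset.sum_product' (f := fun i j => y (edgeKey i j))]
  have : ∑ e, y e = ∑ x ∈ Finset.univ.map (Function.Embedding.subtype
      fun e : Fin n × Fin n => e.1 ≤ e.2), y (edgeKey x.1 x.2) := by
    rw [Finset.sum_map]
    exact Finset.sum_congr rfl fun e _ => by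
      rw [Function.Embedding.subtype_apply, edgeKey_self]
  rw [this]
  exact Finset.sum_le_sum_of_subset_of_nonneg (fun x _ => by simp) fun _ _ _ => hy _

/-- The centred adjacency matrix of a random graph in the configuration `x`. -/
def centeredMatrix (p : Edge n → ℝ) (x : Edge n → Bool) : Matrix (Fin n) (Fin n) ℝ :=
  symMatrix fun e => ind (x e) - p e

theorem centeredMatrix_update_sub (p : Edge n → ℝ) (x : Edge n → Bool) (e : Edge n) :
    centeredMatrix p (Function.update x e true) - centeredMatrix p (Function.update x e false) =
      edgeMatrix e := by
  ext i j
  simp only [centeredMatrix, symMatrix, edgeMatrix, Matrix.sub_apply, Matrix.of_apply,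
    Function.update_apply, Pi.single_apply]
  split_ifs <;> simp [ind]

end Edges

/-! ### Moment bounds for the centred adjacency matrix and its degree vector. -/

section Moments

variable {n : ℕ} {p : Edge n → ℝ}

theorem ind_nonneg (b : Bool) : 0 ≤ ind b := by unfold ind; split_ifs <;> norm_num

/-- One factor is written as a sum over edges and each centred variable is integrated by parts.
Switching an edge on changes the matrix by `edgeMatrix e`, so `trace_mul_pow_sub_pow_le` bounds the
increment. -/
theorem bernoulliMean_trace_pow_succ_le (hp : ∀ e, p e ∈ Set.Icc (0 : ℝ) 1) (k : ℕ) :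
    bernoulliMean p (fun x => (centeredMatrix p x ^ (2 * (k + 1))).trace) ≤
      (2 * k + 1) * bernoulliMean p (fun x => ∑ i, (∑ j, (ind (x (edgeKey i j)) +
        p (edgeKey i j))) * (centeredMatrix p x ^ (2 * k)) i i) := by
  have hs : ∀ x, (centeredMatrix p x).IsSymm := fun x => symMatrix_isSymm _
  have e1 : ∀ x, (centeredMatrix p x ^ (2 * (k + 1))).trace =
      ∑ e, (ind (x e) - p e) * (edgeMatrix e * centeredMatrix p x ^ (2 * k + 1)).trace := by
    intro x
    rw [show 2 * (k + 1) = 2 * k + 1 + 1 by ring, pow_succ']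
    nth_rewrite 1 [centeredMatrix]
    rw [symMatrix_eq_sum, Finset.sum_mul, Matrix.trace_sum]
    simp only [Matrix.smul_mul, Matrix.trace_smul, smul_eq_mul]
  have e2 : ∀ x, ∑ i, (∑ j, (ind (x (edgeKey i j)) + p (edgeKey i j))) *
      (centeredMatrix p x ^ (2 * k)) i i = ∑ e, (ind (x e) + p e) *
        (edgeMatrix e * edgeMatrix e * centeredMatrix p x ^ (2 * k)).trace := fun x =>
    (sum_mul_trace_edgeMatrix_sq (fun e => ind (x e) + p e) _).symm
  simp only [e1, e2]
  rw [bernoulliMean_sum, bernoulliMean_sum, Finset.mul_sum]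
  refine Finset.sum_le_sum fun e _ => ?_
  refine bernoulliMean_centered_mul_le hp e (by positivity)
    (fun x => (edgeMatrix e * centeredMatrix p x ^ (2 * k + 1)).trace)
    (fun x => (edgeMatrix e * edgeMatrix e * centeredMatrix p x ^ (2 * k)).trace) ?_ ?_
  · intro x
    rw [edgeMatrix_mul_self, Matrix.trace]
    refine Finset.sum_nonneg fun i _ => ?_
    rw [Matrix.diag_apply, Matrix.diagonal_mul]
    exact mul_nonneg (sum_edgeMatrix_mem e i).1 (diag_even_pow_nonneg (hs x) k i)
  · intro x
    have := trace_mul_pow_sub_pow_le (hs (Function.update x e true))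
      (hs (Function.update x e false)) k
    rwa [centeredMatrix_update_sub] at this

theorem bernoulliMean_trace_pow_le (hp : ∀ e, p e ∈ Set.Icc (0 : ℝ) 1) {m : ℝ} {k : ℕ}
    (hm : 0 < m) (hk : k ≠ 0) (hkm : (k : ℝ) ≤ m) (hpm : ∀ i, ∑ j, p (edgeKey i j) ≤ m) :
    bernoulliMean p (fun x => (centeredMatrix p x ^ (2 * k)).trace) ≤
      n * (4 * k * (Real.exp 3 * m)) ^ k := by
  obtain ⟨j, rfl⟩ := Nat.exists_eq_succ_of_ne_zero hk
  have hs : ∀ x, (centeredMatrix p x).IsSymm := fun x => symMatrix_isSymm _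
  -- With this `κ`, the prefactor `2j + 1` times the term `T / κ` of Young's inequality is `T / 2`,
  -- which moves to the left side; no induction on the exponent is needed.
  set κ : ℝ := 2 * (2 * j + 1) with hκ
  have hκ0 : 0 < κ := by positivity
  have h1 := bernoulliMean_trace_pow_succ_le hp j
  set T := bernoulliMean p (fun x => (centeredMatrix p x ^ (2 * (j + 1))).trace) with hT
  let N : Fin n → (Edge n → Bool) → ℝ := fun i x =>
    ∑ j, (ind (x (edgeKey i j)) + p (edgeKey i j))
  have hN : ∀ i x, 0 ≤ N i x := fun i x =>
    Finset.sum_nonneg fun j _ => add_nonneg (ind_nonneg _) (hp _).1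
  have h2 : bernoulliMean p (fun x => ∑ i, N i x * (centeredMatrix p x ^ (2 * j)) i i) ≤
      κ ^ j * ∑ i, bernoulliMean p (fun x => N i x ^ (j + 1)) + κ⁻¹ * T := by
    rw [hT, ← bernoulliMean_sum, ← bernoulliMean_const_mul, ← bernoulliMean_const_mul,
      ← bernoulliMean_add]
    refine bernoulliMean_mono hp fun x => ?_
    rw [Finset.mul_sum, Matrix.trace, Finset.mul_sum, ← Finset.sum_add_distrib]
    refine Finset.sum_le_sum fun i _ => ?_
    have := mul_diag_even_pow_le (hs x) j i (hN i x) hκ0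
    rw [Matrix.diag_apply]
    rwa [div_eq_inv_mul] at this
  have h3 : ∀ i, bernoulliMean p (fun x => N i x ^ (j + 1)) ≤ (Real.exp 3 * m) ^ (j + 1) := by
    intro i
    have := bernoulliMean_sum_pow_le hp (c := fun e => ∑ j, edgeMatrix e i j)
      (fun e => sum_edgeMatrix_mem e i) hm hkm
      (by rw [sum_edgeMatrix_mul_eq p i]; exact hpm i)
    have e : ∀ x : Edge n → Bool, ∑ e, (∑ j, edgeMatrix e i j) * (ind (x e) + p e) = N i x :=
      fun x => sum_edgeMatrix_mul_eq (fun e => ind (x e) + p e) i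
    simpa only [e] using this
  have h4 : ∑ i, bernoulliMean p (fun x => N i x ^ (j + 1)) ≤ n * (Real.exp 3 * m) ^ (j + 1) := by
    refine (Finset.sum_le_sum fun i _ => h3 i).trans_eq ?_
    simp
  have h5 : T ≤ κ ^ (j + 1) * ∑ i, bernoulliMean p (fun x => N i x ^ (j + 1)) := by
    have h6 := h1.trans (mul_le_mul_of_nonneg_left h2 (by positivity))
    have h7 : (2 * (j : ℝ) + 1) * (κ⁻¹ * T) = T / 2 := by
      rw [hκ]; field_simp
    rw [mul_add, h7] at h6
    have h8 : κ ^ (j + 1) = 2 * ((2 * j + 1) * κ ^ j) := by rw [pow_succ]; nth_rewrite 2 [hκ]; ring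
    rw [h8]
    linarith
  calc T ≤ κ ^ (j + 1) * (n * (Real.exp 3 * m) ^ (j + 1)) :=
        h5.trans (mul_le_mul_of_nonneg_left h4 (by positivity))
    _ = n * (κ * (Real.exp 3 * m)) ^ (j + 1) := by rw [mul_pow κ]; ring
    _ ≤ _ := by
        gcongr
        rw [hκ]; push_cast; linarith

/-- When `u` and `v` point the same way this is `sub_mul_pow_sub_le` for their norms. In general the
defect `‖u‖ ‖v‖ - ⟪u, v⟫ ≥ 0` enters the right side with the larger coefficient. -/
theorem inner_sub_norm_pow_smul_le {V : Type*} [NormedAddCommGroup V] [InnerProductSpace ℝ V]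
    (u v : V) (k : ℕ) :
    inner ℝ (u - v) u * ‖u‖ ^ (2 * k) - inner ℝ (u - v) v * ‖v‖ ^ (2 * k) ≤
      (2 * k + 1) * (‖u - v‖ ^ 2 * (‖u‖ ^ (2 * k) + ‖v‖ ^ (2 * k))) := by
  have h1 : ‖u - v‖ ^ 2 = ‖u‖ ^ 2 - 2 * inner ℝ u v + ‖v‖ ^ 2 := norm_sub_sq_real u v
  have h2 : inner ℝ (u - v) u = ‖u‖ ^ 2 - inner ℝ u v := by
    rw [inner_sub_left, real_inner_self_eq_norm_sq, real_inner_comm]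
  have h3 : inner ℝ (u - v) v = inner ℝ u v - ‖v‖ ^ 2 := by
    rw [inner_sub_left, real_inner_self_eq_norm_sq]
  have h4 := sub_mul_pow_sub_le ‖u‖ ‖v‖ k
  have h5 : (‖u‖ - ‖v‖) ^ 2 ≤ ‖u - v‖ ^ 2 := by
    rw [← sq_abs]; gcongr; exact abs_norm_sub_norm_le u v
  have h6 := real_inner_le_norm u v
  have ha : 0 ≤ ‖u‖ := norm_nonneg _
  have hb : 0 ≤ ‖v‖ := norm_nonneg _
  rw [h1] at h5 ⊢
  rw [h2, h3]
  set s := ‖u‖; set t := ‖v‖; set c := inner ℝ u v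
  have hA : 0 ≤ s ^ (2 * k) := by positivity
  have hB : 0 ≤ t ^ (2 * k) := by positivity
  rw [pow_succ, pow_succ] at h4
  set a := s ^ (2 * k); set b := t ^ (2 * k)
  have h7 : 0 ≤ (2 * (k : ℝ)) * ((a + b) * (s * t - c)) :=
    mul_nonneg (by positivity) (mul_nonneg (by positivity) (by linarith))
  nlinarith

theorem bernoulliMean_norm_pow_succ_le (hp : ∀ e, p e ∈ Set.Icc (0 : ℝ) 1) (k : ℕ) :
    bernoulliMean p (fun x => ‖degreeVector (centeredMatrix p x)‖ ^ (2 * (k + 1))) ≤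
      (2 * k + 1) * bernoulliMean p (fun x => (2 * ∑ e, (ind (x e) + p e)) *
        ‖degreeVector (centeredMatrix p x)‖ ^ (2 * k)) := by
  have e1 : ∀ x, ‖degreeVector (centeredMatrix p x)‖ ^ (2 * (k + 1)) =
      ∑ e, (ind (x e) - p e) * (inner ℝ (degreeVector (edgeMatrix e))
        (degreeVector (centeredMatrix p x)) * ‖degreeVector (centeredMatrix p x)‖ ^ (2 * k)) := by
    intro x
    rw [show 2 * (k + 1) = 2 + 2 * k by ring, pow_add, ← real_inner_self_eq_norm_sq]
    nth_rewrite 1 [centeredMatrix]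
    rw [degreeVector_symMatrix_eq_sum, sum_inner, Finset.sum_mul]
    exact Finset.sum_congr rfl fun e _ => by rw [real_inner_smul_left]; ring
  have e2 : bernoulliMean p (fun x => ∑ e, (ind (x e) + p e) *
      (‖degreeVector (edgeMatrix e)‖ ^ 2 * ‖degreeVector (centeredMatrix p x)‖ ^ (2 * k))) ≤
      bernoulliMean p (fun x => (2 * ∑ e, (ind (x e) + p e)) *
        ‖degreeVector (centeredMatrix p x)‖ ^ (2 * k)) := by
    refine bernoulliMean_mono hp fun x => ?_
    rw [Finset.mul_sum, Finset.sum_mul]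
    refine Finset.sum_le_sum fun e _ => ?_
    have h1 : 0 ≤ ind (x e) + p e := add_nonneg (ind_nonneg _) (hp e).1
    calc _ ≤ (ind (x e) + p e) * (2 * ‖degreeVector (centeredMatrix p x)‖ ^ (2 * k)) := by
          gcongr
          exact norm_sq_degreeVector_edgeMatrix_le e
      _ = _ := by ring
  refine le_trans ?_ (mul_le_mul_of_nonneg_left e2 (by positivity))
  simp only [e1]
  rw [bernoulliMean_sum, bernoulliMean_sum, Finset.mul_sum]
  refine Finset.sum_le_sum fun e _ => ?_
  refine bernoulliMean_centered_mul_le hp e (by positivity)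
    (fun x => inner ℝ (degreeVector (edgeMatrix e))
        (degreeVector (centeredMatrix p x)) * ‖degreeVector (centeredMatrix p x)‖ ^ (2 * k))
    (fun x => ‖degreeVector (edgeMatrix e)‖ ^ 2 *
      ‖degreeVector (centeredMatrix p x)‖ ^ (2 * k)) (fun x => by positivity) fun x => ?_
  have h := inner_sub_norm_pow_smul_le
    (degreeVector (centeredMatrix p (Function.update x e true)))
    (degreeVector (centeredMatrix p (Function.update x e false))) k
  have h2 : degreeVector (centeredMatrix p (Function.update x e true)) -
      degreeVector (centeredMatrix p (Function.update x e false)) =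
      degreeVector (edgeMatrix e) := by
    rw [← centeredMatrix_update_sub p x e]
    ext i
    simp [degreeVector]
  rw [h2, mul_add] at h
  exact h

theorem bernoulliMean_norm_pow_le (hp : ∀ e, p e ∈ Set.Icc (0 : ℝ) 1) {m : ℝ} {k : ℕ}
    (hm : 0 < m) (hk : k ≠ 0) (hkm : (k : ℝ) ≤ m) (hpm : ∑ e, p e ≤ m) :
    bernoulliMean p (fun x => ‖degreeVector (centeredMatrix p x)‖ ^ (2 * k)) ≤
      (8 * k * (Real.exp 3 * m)) ^ k := by
  obtain ⟨j, rfl⟩ := Nat.exists_eq_succ_of_ne_zero hk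
  set κ : ℝ := 2 * (2 * j + 1) with hκ
  have hκ0 : 0 < κ := by positivity
  have h1 := bernoulliMean_norm_pow_succ_le hp j
  set T := bernoulliMean p (fun x => ‖degreeVector (centeredMatrix p x)‖ ^ (2 * (j + 1))) with hT
  let N : (Edge n → Bool) → ℝ := fun x => ∑ e, (ind (x e) + p e)
  have hN : ∀ x, 0 ≤ N x := fun x =>
    Finset.sum_nonneg fun j _ => add_nonneg (ind_nonneg _) (hp _).1
  have h2 : bernoulliMean p (fun x => (2 * N x) *
      ‖degreeVector (centeredMatrix p x)‖ ^ (2 * j)) ≤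
      κ ^ j * 2 ^ (j + 1) * bernoulliMean p (fun x => N x ^ (j + 1)) + κ⁻¹ * T := by
    rw [hT, ← bernoulliMean_const_mul, ← bernoulliMean_const_mul, ← bernoulliMean_add]
    refine bernoulliMean_mono hp fun x => ?_
    have := mul_pow_le_add (mul_nonneg zero_le_two (hN x))
      (sq_nonneg ‖degreeVector (centeredMatrix p x)‖) hκ0 j
    rw [← pow_mul, ← pow_mul, div_eq_inv_mul, mul_pow 2 (N x), ← mul_assoc (κ ^ j)] at this
    exact this
  have h3 : bernoulliMean p (fun x => N x ^ (j + 1)) ≤ (Real.exp 3 * m) ^ (j + 1) := by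
    have := bernoulliMean_sum_pow_le hp (c := fun _ => 1)
      (fun e => by simp) hm hkm (by simpa using hpm)
    simpa only [one_mul] using this
  -- Again half of `T` is absorbed. The extra `2` is the bound on the squared norm of the degree
  -- vector of one edge.
  have h5 : T ≤ (2 * κ) ^ (j + 1) * bernoulliMean p (fun x => N x ^ (j + 1)) := by
    have h6 := h1.trans (mul_le_mul_of_nonneg_left h2 (by positivity))
    have h7 : (2 * (j : ℝ) + 1) * (κ⁻¹ * T) = T / 2 := by
      rw [hκ]; field_simp
    rw [mul_add, h7] at h6
    have h8 : (2 * κ) ^ (j + 1) = 2 * ((2 * j + 1) * (κ ^ j * 2 ^ (j + 1))) := by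
      rw [mul_pow, pow_succ κ]; nth_rewrite 2 [hκ]; ring
    rw [h8]
    linarith
  calc T ≤ (2 * κ) ^ (j + 1) * (Real.exp 3 * m) ^ (j + 1) :=
        h5.trans (mul_le_mul_of_nonneg_left h3 (by positivity))
    _ = (2 * κ * (Real.exp 3 * m)) ^ (j + 1) := by rw [mul_pow (2 * κ)]
    _ ≤ _ := by
        gcongr ?_ ^ _
        refine mul_le_mul_of_nonneg_right ?_ (by positivity)
        rw [hκ]; push_cast; linarith

end Moments

/-! ### Welfare and the top eigenvector: the deterministic comparison. -/

section Welfare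

variable {n : ℕ} {A : Matrix (Fin n) (Fin n) ℝ}

theorem inner_eq_dotProduct (x y : EuclideanSpace ℝ (Fin n)) :
    inner ℝ x y = x.ofLp ⬝ᵥ y.ofLp := by
  rw [EuclideanSpace.inner_eq_star_dotProduct, star_trivial, dotProduct_comm]

theorem norm_sq_eq_dotProduct (x : EuclideanSpace ℝ (Fin n)) :
    ‖x‖ ^ 2 = x.ofLp ⬝ᵥ x.ofLp := by
  rw [← real_inner_self_eq_norm_sq, inner_eq_dotProduct]

theorem dotProduct_mulVec_comm (hA : A.IsSymm) (x y : Fin n → ℝ) :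
    x ⬝ᵥ (A *ᵥ y) = (A *ᵥ x) ⬝ᵥ y := by
  rw [Matrix.dotProduct_mulVec, ← Matrix.mulVec_transpose, hA]

/-- A symmetric matrix has a unit eigenvector whose eigenvalue bounds the quadratic form. -/
theorem exists_top_eigenvector [NeZero n] (hA : A.IsSymm) :
    ∃ (v : EuclideanSpace ℝ (Fin n)) (l : ℝ), ‖v‖ = 1 ∧ A *ᵥ v.ofLp = l • v.ofLp ∧
      ∀ x : Fin n → ℝ, x ⬝ᵥ (A *ᵥ x) ≤ l * (x ⬝ᵥ x) := by
  obtain ⟨U, l, U1, U2, hl⟩ := exists_orthogonal_diagonalization hA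
  have hAU := hl 1
  simp only [pow_one] at hAU
  obtain ⟨i, hi⟩ := Finite.exists_max l
  refine ⟨WithLp.toLp 2 (U *ᵥ Pi.single i 1), l i, ?_, ?_, fun x => ?_⟩
  · have : ‖WithLp.toLp 2 (U *ᵥ Pi.single i (1 : ℝ))‖ ^ 2 = 1 := by
      rw [norm_sq_eq_dotProduct, Matrix.dotProduct_mulVec, ← Matrix.mulVec_transpose,
        Matrix.mulVec_mulVec, U1, Matrix.one_mulVec]
      simp
    exact (pow_eq_one_iff_of_nonneg (norm_nonneg _) two_ne_zero).1 this
  · change A *ᵥ (U *ᵥ Pi.single i 1) = l i • (U *ᵥ Pi.single i 1)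
    rw [hAU, Matrix.mulVec_mulVec, Matrix.mul_assoc, U1, Matrix.mul_one, ← Matrix.mulVec_mulVec,
      ← Matrix.mulVec_smul]
    congr 1
    ext j
    rw [Matrix.mulVec_diagonal]
    by_cases h : j = i
    · subst h; simp
    · simp [h]
  · have hq : x ⬝ᵥ (A *ᵥ x) = ∑ i, l i * (Uᵀ *ᵥ x) i ^ 2 := by
      rw [hAU, ← Matrix.mulVec_mulVec, ← Matrix.mulVec_mulVec, Matrix.dotProduct_mulVec,
        ← Matrix.mulVec_transpose, dotProduct]
      exact Finset.sum_congr rfl fun i _ => by rw [Matrix.mulVec_diagonal]; ring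
    have hn : x ⬝ᵥ x = ∑ i, (Uᵀ *ᵥ x) i ^ 2 := by
      have : x = U *ᵥ (Uᵀ *ᵥ x) := by rw [Matrix.mulVec_mulVec, U2, Matrix.one_mulVec]
      nth_rewrite 2 [this]
      rw [Matrix.dotProduct_mulVec, ← Matrix.mulVec_transpose, dotProduct]
      exact Finset.sum_congr rfl fun i _ => by ring
    rw [hq, hn, Finset.mul_sum]
    exact Finset.sum_le_sum fun j _ => mul_le_mul_of_nonneg_right (hi j) (sq_nonneg _)

theorem mul_eigenvalue_lt_one {β : ℝ} (hβ : 0 < β)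
    (hr : spectralRadius ℝ A < ENNReal.ofReal (1 / β)) {v : Fin n → ℝ} {l : ℝ} (hv : v ≠ 0)
    (h : A *ᵥ v = l • v) : β * l < 1 := by
  by_contra! hl
  have h1 : 1 / β ≤ l := by rw [div_le_iff₀ hβ]; linarith
  have h2 : spectralRadius ℝ A < ‖l‖₊ := by
    refine hr.trans_le ?_
    rw [ENNReal.ofReal, ENNReal.coe_le_coe, ← NNReal.coe_le_coe,
      Real.coe_toNNReal _ (by positivity), coe_nnnorm]
    exact h1.trans (le_abs_self l)
  have h3 := spectrum.mem_resolventSet_of_spectralRadius_lt h2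
  rw [spectrum.mem_resolventSet_iff] at h3
  obtain ⟨B, hB⟩ := h3.exists_left_inv
  refine hv ?_
  rw [← Matrix.one_mulVec v, ← hB, ← Matrix.mulVec_mulVec, Matrix.sub_mulVec, h,
    Algebra.algebraMap_eq_smul_one, Matrix.smul_mulVec, Matrix.one_mulVec, sub_self,
    Matrix.mulVec_zero]

theorem equilibrium_sub {β : ℝ} (hβ : 0 < β)
    (hr : spectralRadius ℝ A < ENNReal.ofReal (1 / β)) (c : EuclideanSpace ℝ (Fin n)) :
    (equilibrium A β c).ofLp - β • (A *ᵥ (equilibrium A β c).ofLp) = c.ofLp := by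
  have h2 : spectralRadius ℝ A < ‖1 / β‖₊ := by
    refine hr.trans_le (le_of_eq ?_)
    rw [ENNReal.ofReal, ENNReal.coe_inj, ← NNReal.coe_inj,
      Real.coe_toNNReal _ (by positivity), coe_nnnorm, Real.norm_of_nonneg (by positivity)]
  have h3 := spectrum.mem_resolventSet_of_spectralRadius_lt h2
  rw [spectrum.mem_resolventSet_iff] at h3
  have h4 : IsUnit (1 - β • A) := by
    have h5 : 1 - β • A = (algebraMap ℝ (Matrix (Fin n) (Fin n) ℝ) β) *
        (algebraMap ℝ _ (1 / β) - A) := by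
      rw [mul_sub, ← map_mul, mul_one_div_cancel hβ.ne', map_one,
        Algebra.algebraMap_eq_smul_one β, smul_mul_assoc, one_mul]
    rw [h5]
    exact ((isUnit_iff_ne_zero.2 hβ.ne').map _).mul h3
  have h6 : (1 - β • A) *ᵥ (equilibrium A β c).ofLp = c.ofLp := by
    rw [equilibrium, Matrix.mulVec_mulVec,
      Matrix.mul_nonsing_inv _ ((Matrix.isUnit_iff_isUnit_det _).1 h4), Matrix.one_mulVec]
  rwa [Matrix.sub_mulVec, Matrix.one_mulVec, Matrix.smul_mulVec] at h6

/-- Eliminating the standalone values through the best-response equation cancels the network terms.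
-/
theorem welfare_eq {β : ℝ} (hβ : 0 < β) (hr : spectralRadius ℝ A < ENNReal.ofReal (1 / β))
    (b y : EuclideanSpace ℝ (Fin n)) :
    welfare A β b y = 1 / 2 * ‖equilibrium A β (b + y)‖ ^ 2 := by
  have h := equilibrium_sub hβ hr (b + y)
  rw [welfare, norm_sq_eq_dotProduct, dotProduct, Finset.mul_sum]
  set a := equilibrium A β (b + y)
  refine Finset.sum_congr rfl fun i _ => ?_
  have hi := congrFun h i
  rw [Pi.sub_apply, Pi.smul_apply, smul_eq_mul, Matrix.mulVec, dotProduct] at hi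
  rw [utility, ← hi]
  have : ∑ j, A i j * a i * a j = a i * ∑ j, A i j * a j := by
    rw [Finset.mul_sum]; exact Finset.sum_congr rfl fun j _ => by ring
  rw [this]
  ring

/-- Write `c = a - β A a`. Pairing with `v` gives `⟪v, c⟫ = (1 - β l) ⟪v, a⟫`, hence the lower
bound. Pairing with `a` gives `(1 - β l) ‖a‖² ≤ ⟪a, c⟫ ≤ ‖a‖ ‖c‖`, hence the upper one. -/
theorem welfare_bounds (hA : A.IsSymm) {β : ℝ} (hβ : 0 < β)
    (hr : spectralRadius ℝ A < ENNReal.ofReal (1 / β)) {v : EuclideanSpace ℝ (Fin n)} {l : ℝ}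
    (hv : ‖v‖ = 1) (hl : A *ᵥ v.ofLp = l • v.ofLp)
    (hq : ∀ x : Fin n → ℝ, x ⬝ᵥ (A *ᵥ x) ≤ l * (x ⬝ᵥ x)) (b y : EuclideanSpace ℝ (Fin n)) :
    inner ℝ v (b + y) ^ 2 ≤ 2 * (1 - β * l) ^ 2 * welfare A β b y ∧
      2 * (1 - β * l) ^ 2 * welfare A β b y ≤ ‖b + y‖ ^ 2 := by
  rw [welfare_eq hβ hr]
  have h := equilibrium_sub hβ hr (b + y)
  set a := equilibrium A β (b + y)
  set c := b + y
  have hv0 : v.ofLp ≠ 0 := by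
    intro h0
    have := norm_sq_eq_dotProduct v
    rw [h0, hv] at this
    simp at this
  have hl1 := mul_eigenvalue_lt_one hβ hr hv0 hl
  have e1 : inner ℝ v c = (1 - β * l) * inner ℝ v a := by
    rw [inner_eq_dotProduct, inner_eq_dotProduct, ← h, dotProduct_sub, dotProduct_smul,
      dotProduct_mulVec_comm hA, hl, smul_dotProduct, smul_eq_mul, smul_eq_mul]
    ring
  have e2 : (1 - β * l) * ‖a‖ ^ 2 ≤ inner ℝ a c := by
    rw [inner_eq_dotProduct, norm_sq_eq_dotProduct, ← h, dotProduct_sub, dotProduct_smul,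
      smul_eq_mul]
    nlinarith [hq a.ofLp]
  have e3 := real_inner_le_norm a c
  have e4 := abs_real_inner_le_norm v a
  rw [hv, one_mul] at e4
  have e5 : (1 - β * l) * ‖a‖ ≤ ‖c‖ := by
    rcases (norm_nonneg a).eq_or_lt with h0 | h0
    · rw [← h0, mul_zero]; exact norm_nonneg c
    · refine le_of_mul_le_mul_left ?_ h0
      nlinarith
  have e6 : inner ℝ v a ^ 2 ≤ ‖a‖ ^ 2 := by rw [← sq_abs]; gcongr
  constructor
  · rw [e1, mul_pow]
    nlinarith [mul_le_mul_of_nonneg_left e6 (sq_nonneg (1 - β * l))]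
  · have : ((1 - β * l) * ‖a‖) ^ 2 ≤ ‖c‖ ^ 2 :=
      pow_le_pow_left₀ (mul_nonneg (by linarith) (norm_nonneg _)) e5 2
    nlinarith

/-- If `A` is close to the rank one matrix `d w wᵀ / ‖w‖²` and its degrees are close to `w`, the
intervention proportional to the degrees is nearly optimal. -/
theorem welfare_ratio_ge (hA : A.IsSymm) {w : EuclideanSpace ℝ (Fin n)} {d ε : ℝ} (hw : w ≠ 0)
    (hd : 0 < d) (hε : 0 < ε) (hε1 : 16 * ε < 1)
    (hquad : ∀ x : EuclideanSpace ℝ (Fin n),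
      |x.ofLp ⬝ᵥ (A *ᵥ x.ofLp) - d * (inner ℝ w x / ‖w‖) ^ 2| ≤ ε ^ 2 * d / 16 * ‖x‖ ^ 2)
    (hdeg : ‖w - degreeVector A‖ ≤ 3 * (ε * ‖w‖)) {b : EuclideanSpace ℝ (Fin n)} {β C : ℝ}
    (hβ : 0 < β) (hr : spectralRadius ℝ A < ENNReal.ofReal (1 / β)) (hC : 0 < C)
    (hbC : 256 * ‖b‖ ^ 2 / (ε * β * d) ^ 2 ≤ C) {z : EuclideanSpace ℝ (Fin n)}
    (hz : IsOptimalIntervention A β b C z) :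
    1 - 16 * ε ≤ welfare A β b (degreeIntervention A C) / welfare A β b z := by
  have hn : NeZero n := ⟨by rintro rfl; exact hw (Subsingleton.elim _ _)⟩
  have hw0 : 0 < ‖w‖ := norm_pos_iff.2 hw
  obtain ⟨v, l, hv, hl, hq, hvw⟩ : ∃ (v : EuclideanSpace ℝ (Fin n)) (l : ℝ), ‖v‖ = 1 ∧
      A *ᵥ v.ofLp = l • v.ofLp ∧ (∀ x : Fin n → ℝ, x ⬝ᵥ (A *ᵥ x) ≤ l * (x ⬝ᵥ x)) ∧
      0 ≤ inner ℝ w v := by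
    obtain ⟨v, l, hv, hl, hq⟩ := exists_top_eigenvector hA
    rcases le_total 0 (inner ℝ w v) with h | h
    · exact ⟨v, l, hv, hl, hq, h⟩
    · refine ⟨-v, l, by rwa [norm_neg], ?_, hq, by rw [inner_neg_right]; linarith⟩
      rw [WithLp.ofLp_neg, Matrix.mulVec_neg, hl, smul_neg]
  have hv0 : v.ofLp ≠ 0 := by
    intro h0
    have := norm_sq_eq_dotProduct v
    rw [h0, hv] at this
    simp at this
  have hl1 := mul_eigenvalue_lt_one hβ hr hv0 hl
  -- the top eigenvalue is close to `d` and its eigenvector is close to `w`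
  have hld : d - ε ^ 2 * d / 16 ≤ l := by
    have h1 := (abs_le.1 (hquad w)).1
    have h2 := hq w.ofLp
    rw [← norm_sq_eq_dotProduct] at h2
    rw [real_inner_self_eq_norm_sq, sq ‖w‖, mul_div_cancel_right₀ _ hw0.ne'] at h1
    refine le_of_mul_le_mul_right ?_ (pow_pos hw0 2)
    nlinarith
  set g := inner ℝ w v / ‖w‖ with hg
  have hg0 : 0 ≤ g := div_nonneg hvw hw0.le
  -- The form at `v` equals `l`, so `d - ε² d / 16 ≤ l ≤ d g² + ε² d / 16`. Thus `g² ≥ 1 - ε² / 8`,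
  -- which is at least `(1 - ε / 8)²`.
  have hg1 : 1 - ε / 8 ≤ g := by
    have h1 := (abs_le.1 (hquad v)).2
    rw [hl, dotProduct_smul, ← norm_sq_eq_dotProduct, hv, smul_eq_mul] at h1
    have h2 : d * (1 - ε ^ 2 / 8) ≤ d * g ^ 2 := by linarith
    have h3 := le_of_mul_le_mul_left h2 hd
    nlinarith
  -- Since `β l < 1` and `l ≥ d / 2`. This removes `β d` from the budget condition and leaves `‖b‖ ≤
  -- √C ε / 8`.
  have hβd : β * d ≤ 2 := by
    have h0 : ε ^ 2 ≤ 1 := pow_le_one₀ hε.le (by linarith)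
    have h1 : d / 2 ≤ l := by nlinarith
    nlinarith
  have hsC : 0 < √C := Real.sqrt_pos.2 hC
  have hb : ‖b‖ ≤ √C * (ε / 8) := by
    have hp : 0 < ε * β * d := by positivity
    rw [div_le_iff₀ (by positivity)] at hbC
    have h1 : ‖b‖ ^ 2 ≤ (√C * (ε * β * d / 16)) ^ 2 := by
      rw [mul_pow, Real.sq_sqrt hC.le]; linarith
    have h2 := (abs_le_of_sq_le_sq h1 (by positivity))
    rw [abs_of_nonneg (norm_nonneg b)] at h2
    refine h2.trans (mul_le_mul_of_nonneg_left ?_ hsC.le)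
    nlinarith
  -- the realized degrees
  set D := degreeVector A with hD
  have hDlow : (1 - 3 * ε) * ‖w‖ ≤ ‖D‖ := by
    have := norm_sub_norm_le w D
    linarith
  have hDup : ‖D‖ ≤ (1 + 3 * ε) * ‖w‖ := by
    have := norm_sub_norm_le D w
    rw [norm_sub_rev] at this
    linarith
  have hD0 : 0 < ‖D‖ := lt_of_lt_of_le (mul_pos (by linarith) hw0) hDlow
  have hvD : (1 - 4 * ε) * ‖w‖ ≤ inner ℝ v D := by
    have h1 : inner ℝ v D = inner ℝ w v - inner ℝ v (w - D) := by
      rw [inner_sub_right, real_inner_comm v w]; ring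
    have h2 := real_inner_le_norm v (w - D)
    have h3 : inner ℝ w v = g * ‖w‖ := by rw [hg, div_mul_cancel₀ _ hw0.ne']
    rw [hv, one_mul] at h2
    rw [h1, h3]
    nlinarith
  have hvy : √C * (1 - 7 * ε) ≤ inner ℝ v (degreeIntervention A C) := by
    rw [degreeIntervention, real_inner_smul_right, ← hD, div_mul_eq_mul_div,
      le_div_iff₀ hD0, mul_assoc]
    refine mul_le_mul_of_nonneg_left ?_ hsC.le
    calc (1 - 7 * ε) * ‖D‖ ≤ (1 - 7 * ε) * ((1 + 3 * ε) * ‖w‖) :=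
          mul_le_mul_of_nonneg_left hDup (by linarith)
      _ = ((1 - 7 * ε) * (1 + 3 * ε)) * ‖w‖ := by ring
      _ ≤ (1 - 4 * ε) * ‖w‖ := mul_le_mul_of_nonneg_right (by nlinarith) hw0.le
      _ ≤ _ := hvD
  have hynorm : ‖degreeIntervention A C‖ = √C := by
    rw [degreeIntervention, norm_smul, ← hD, Real.norm_of_nonneg (by positivity),
      div_mul_cancel₀ _ hD0.ne']
  -- comparison of the welfares
  have hlow : C * (1 - 57 / 8 * ε) ^ 2 ≤
      2 * (1 - β * l) ^ 2 * welfare A β b (degreeIntervention A C) := by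
    refine le_trans ?_ (welfare_bounds hA hβ hr hv hl hq b _).1
    have h1 : √C * (1 - 57 / 8 * ε) ≤ inner ℝ v (b + degreeIntervention A C) := by
      rw [inner_add_right]
      have h2 := (abs_le.1 (abs_real_inner_le_norm v b)).1
      rw [hv, one_mul] at h2
      nlinarith
    calc C * (1 - 57 / 8 * ε) ^ 2 = (√C * (1 - 57 / 8 * ε)) ^ 2 := by rw [mul_pow, Real.sq_sqrt hC.le]
      _ ≤ _ := pow_le_pow_left₀ (mul_nonneg hsC.le (by linarith)) h1 2
  have hup : 2 * (1 - β * l) ^ 2 * welfare A β b z ≤ C * (1 + ε / 8) ^ 2 := by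
    refine (welfare_bounds hA hβ hr hv hl hq b z).2.trans ?_
    have h1 : ‖b + z‖ ≤ √C * (1 + ε / 8) := by
      have := norm_add_le b z
      rw [hz.1] at this
      linarith
    calc ‖b + z‖ ^ 2 ≤ (√C * (1 + ε / 8)) ^ 2 := pow_le_pow_left₀ (norm_nonneg _) h1 2
      _ = _ := by rw [mul_pow, Real.sq_sqrt hC.le]
  have hγ : 0 < 2 * (1 - β * l) ^ 2 := by
    have : 0 < 1 - β * l := by linarith
    positivity
  have hzpos : 0 < welfare A β b z := by
    have h1 : 0 < C * (1 - 57 / 8 * ε) ^ 2 := mul_pos hC (pow_pos (by linarith) 2)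
    have h2 := pos_of_mul_pos_right (h1.trans_le hlow) hγ.le
    exact h2.trans_le (hz.2 _ hynorm)
  rw [le_div_iff₀ hzpos]
  refine le_of_mul_le_mul_left ?_ hγ
  have h1 : (1 - 16 * ε) * (1 + ε / 8) ^ 2 ≤ (1 - 57 / 8 * ε) ^ 2 := by
    nlinarith [sq_nonneg ε, pow_pos hε 3]
  calc 2 * (1 - β * l) ^ 2 * ((1 - 16 * ε) * welfare A β b z)
      = (1 - 16 * ε) * (2 * (1 - β * l) ^ 2 * welfare A β b z) := by ring
    _ ≤ (1 - 16 * ε) * (C * (1 + ε / 8) ^ 2) := mul_le_mul_of_nonneg_left hup (by linarith)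
    _ = C * ((1 - 16 * ε) * (1 + ε / 8) ^ 2) := by ring
    _ ≤ C * (1 - 57 / 8 * ε) ^ 2 := mul_le_mul_of_nonneg_left h1 hC.le
    _ ≤ _ := hlow

end Welfare

/-! ### Transfer from the probability space to finite configurations. -/

section Configuration

variable {Ω : Type*} [MeasurableSpace Ω] {P : Measure Ω} {n : ℕ}
  {q : Matrix (Fin n) (Fin n) ℝ} {A : Ω → Matrix (Fin n) (Fin n) ℝ}

open Classical in
/-- The set of edges of a graph, as a Boolean function on the unordered pairs of vertices. -/
def configuration (A : Matrix (Fin n) (Fin n) ℝ) (e : Edge n) : Bool := decide (A e.1.1 e.1.2 = 1)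

theorem symMatrix_apply_of_isSymm {M : Matrix (Fin n) (Fin n) ℝ} (hM : M.IsSymm) :
    symMatrix (fun e : Edge n => M e.1.1 e.1.2) = M := by
  ext i j
  simp only [symMatrix, Matrix.of_apply, edgeKey]
  split_ifs
  · rfl
  · exact hM.apply i j

theorem symMatrix_configuration {M : Matrix (Fin n) (Fin n) ℝ} (hM : M.IsSymm)
    (h01 : ∀ i j, M i j = 0 ∨ M i j = 1) :
    symMatrix (fun e => ind (configuration M e)) = M := by
  rw [← symMatrix_apply_of_isSymm hM]
  congr 1
  ext e
  rw [symMatrix_apply_of_isSymm hM]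
  rcases h01 e.1.1 e.1.2 with h | h <;> simp [configuration, ind, h]

theorem IsIndepEdgeGraph.prob_configuration [IsProbabilityMeasure P]
    (hA : IsIndepEdgeGraph P q A) (x : Edge n → Bool) :
    P.real {ω | configuration (A ω) = x} = bernoulliWeight (fun e => q e.1.1 e.1.2) x := by
  have h := hA.indep.measure_inter_preimage_eq_mul Finset.univ
    (sets := fun e : Edge n => if x e then {(1 : ℝ)} else {(1 : ℝ)}ᶜ) (fun e _ => by
      split_ifs
      · exact measurableSet_singleton _
      · exact (measurableSet_singleton _).compl)
  have hset : {ω | configuration (A ω) = x} = ⋂ e ∈ (Finset.univ : Finset (Edge n)),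
      (fun ω => A ω e.1.1 e.1.2) ⁻¹' (if x e then {(1 : ℝ)} else {(1 : ℝ)}ᶜ) := by
    ext ω
    simp only [Set.mem_ofPred_eq, Finset.mem_univ, Set.iInter_true, Set.mem_iInter,
      Set.mem_preimage, funext_iff]
    refine forall_congr' fun e => ?_
    cases hx : x e <;> simp [configuration]
  rw [hset, Measure.real, h, ENNReal.toReal_prod, bernoulliWeight]
  refine Finset.prod_congr rfl fun e _ => ?_
  have h1 : P.real {ω | A ω e.1.1 e.1.2 = 1} = q e.1.1 e.1.2 := hA.prob_edge _ _
  have hm : MeasurableSet {ω | A ω e.1.1 e.1.2 = 1} :=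
    hA.measurable_entry e.1.1 e.1.2 (measurableSet_singleton 1)
  split_ifs
  · exact h1
  · rw [← h1, ← probReal_compl_eq_one_sub hm]
    rfl

theorem IsIndepEdgeGraph.prob_mem_le [IsProbabilityMeasure P] (hA : IsIndepEdgeGraph P q A)
    (B : Finset (Edge n → Bool)) :
    P.real {ω | configuration (A ω) ∈ B} ≤
      ∑ x ∈ B, bernoulliWeight (fun e => q e.1.1 e.1.2) x := by
  have : {ω | configuration (A ω) ∈ B} = ⋃ x ∈ B, {ω | configuration (A ω) = x} := by
    ext ω; simp
  rw [this]
  refine (measureReal_biUnion_finset_le _ _).trans_eq ?_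
  exact Finset.sum_congr rfl fun x _ => hA.prob_configuration x

/-- Only subadditivity is used, so `s` need not be measurable. This matters because the final event
quantifies over all `b`, `β` and `C`. -/
theorem IsIndepEdgeGraph.one_sub_le_prob [IsProbabilityMeasure P] (hA : IsIndepEdgeGraph P q A)
    (B : Finset (Edge n → Bool)) {s : Set Ω} (hs : ∀ ω, configuration (A ω) ∉ B → ω ∈ s) :
    1 - ∑ x ∈ B, bernoulliWeight (fun e => q e.1.1 e.1.2) x ≤ P.real s := by
  have h1 : Set.univ ⊆ s ∪ {ω | configuration (A ω) ∈ B} := fun ω _ =>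
    or_iff_not_imp_right.2 (hs ω)
  have h2 := (measureReal_mono (μ := P) h1).trans (measureReal_union_le _ _)
  rw [probReal_univ] at h2
  have h3 := hA.prob_mem_le B
  linarith

end Configuration

/-! ### The expected matrix of the `G(w)` model and the choice of parameters. -/

section GW

variable {n : ℕ} {w : EuclideanSpace ℝ (Fin n)}

/-- The expected number of self-loops that the model without self-loops discards. -/
def loopWeight (loops : Bool) (w : EuclideanSpace ℝ (Fin n)) (i : Fin n) : ℝ :=
  if loops = false then w i * w i / ∑ k, w k else 0

theorem gwMatrix_eq (loops : Bool) (w : EuclideanSpace ℝ (Fin n)) :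
    gwMatrix loops w = (∑ k, w k)⁻¹ • Matrix.vecMulVec w.ofLp w.ofLp -
      Matrix.diagonal (loopWeight loops w) := by
  ext i j
  simp only [gwMatrix, Matrix.of_apply, Matrix.sub_apply, Matrix.smul_apply, smul_eq_mul,
    Matrix.vecMulVec_apply, Matrix.diagonal_apply, loopWeight]
  by_cases h : i = j
  · subst h
    cases loops <;> simp [div_eq_inv_mul]
  · simp [h, div_eq_inv_mul]

theorem gwMatrix_isSymm (loops : Bool) (w : EuclideanSpace ℝ (Fin n)) :
    (gwMatrix loops w).IsSymm := by
  ext i j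
  simp only [gwMatrix, Matrix.transpose_apply, Matrix.of_apply]
  simp only [eq_comm (a := j), mul_comm (w j)]

theorem dotProduct_gwMatrix_mulVec (loops : Bool) (w : EuclideanSpace ℝ (Fin n))
    (x : Fin n → ℝ) :
    x ⬝ᵥ (gwMatrix loops w *ᵥ x) =
      (w.ofLp ⬝ᵥ x) ^ 2 / ∑ k, w k - ∑ i, loopWeight loops w i * x i ^ 2 := by
  rw [gwMatrix_eq, Matrix.sub_mulVec, dotProduct_sub, Matrix.smul_mulVec, dotProduct_smul,
    Matrix.vecMulVec_mulVec]
  congr 1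
  · simp only [dotProduct_smul, smul_eq_mul, MulOpposite.smul_eq_mul_unop, MulOpposite.unop_op]
    rw [dotProduct_comm x]; ring
  · exact Finset.sum_congr rfl fun i _ => by rw [Matrix.mulVec_diagonal]; ring

theorem gwMatrix_sum_apply (loops : Bool) (hS : ∑ k, w k ≠ 0) (i : Fin n) :
    ∑ j, gwMatrix loops w i j = w i - loopWeight loops w i := by
  simp only [gwMatrix_eq, Matrix.sub_apply, Matrix.smul_apply, smul_eq_mul,
    Matrix.vecMulVec_apply, Finset.sum_sub_distrib, Matrix.diagonal_apply, Finset.sum_ite_eq,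
    Finset.mem_univ, if_true]
  rw [← Finset.mul_sum, ← Finset.mul_sum]
  field_simp

/-- Numerical consequences of `(ε, δ)`-concentration. -/
theorem GWConcentration.bounds {ε δ : ℝ} (h : GWConcentration w ε δ) (hw : ∀ i, 0 ≤ w i)
    (hwS : ∀ i, w i ≤ √(∑ k, w k)) :
    ∃ (k : ℕ) (m : ℝ), k ≠ 0 ∧ 0 < m ∧ (k : ℝ) ≤ m ∧ m ≤ ∑ i, w i ∧ (∀ i, w i ≤ m) ∧
      m ≤ ε * ∑ i, w i ∧ m ^ 2 ≤ ∑ i, w i ∧ 2 * n ≤ δ * Real.exp 1 ^ k ∧ 1 ≤ n ∧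
      √(Real.exp 1 * (4 * k * (Real.exp 3 * m))) + 1 ≤ ε ^ 2 * secondOrderAvg w / 16 ∧
      √(Real.exp 1 * (8 * k * (Real.exp 3 * ∑ i, w i))) ≤ 2 * (ε * ‖w‖) := by
  obtain ⟨hε0, hε1⟩ := h.eps_mem
  obtain ⟨hδ0, hδ1⟩ := h.delta_mem
  have hd := h.le_secondOrderAvg
  set L := Real.log (2 * n / δ) with hL
  set m := maxWeight w with hm
  set s := √(4 * m * L) with hs
  set d := secondOrderAvg w with hdd
  have hs0 : 0 ≤ s := Real.sqrt_nonneg _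
  rw [div_le_iff₀ (by positivity)] at hd
  have hε2 : ε ^ 2 ≤ ε := by nlinarith
  have hd0 : 0 < d := by
    by_contra! hneg
    nlinarith [sq_nonneg ε]
  have hn : 1 ≤ n := by
    rcases Nat.eq_zero_or_pos n with rfl | hn
    · simp [hdd, secondOrderAvg] at hd0
    · exact hn
  have hn' : (1 : ℝ) ≤ n := by exact_mod_cast hn
  have : NeZero n := ⟨by omega⟩
  have hwm : ∀ i, w i ≤ m := fun i => le_ciSup (Set.finite_range w.ofLp).bddAbove i
  have hmS : m ≤ √(∑ k, w k) := ciSup_le hwS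
  have hS0 : 0 ≤ ∑ k, w k := Finset.sum_nonneg fun i _ => hw i
  have hSpos : 0 < ∑ k, w k := by
    refine hS0.lt_of_ne fun h0 => ?_
    rw [hdd, secondOrderAvg, ← h0, div_zero] at hd0
    exact lt_irrefl _ hd0
  have hwsq : ‖w‖ ^ 2 = d * ∑ k, w k := by
    rw [hdd, secondOrderAvg, div_mul_cancel₀ _ hSpos.ne', EuclideanSpace.norm_sq_eq]
    simp only [Real.norm_eq_abs, sq_abs]
  -- `d` is an average of the `w i` with weights `w i`. Combined with the concentration condition,
  -- `m` is large compared with `s`, and `s` with `L`.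
  have hdm : d ≤ m := by
    rw [hdd, secondOrderAvg, div_le_iff₀ hSpos, Finset.mul_sum]
    refine Finset.sum_le_sum fun i _ => ?_
    nlinarith [hw i, hwm i]
  have hm0 : 0 < m := hd0.trans_le hdm
  have hm2 : m ^ 2 ≤ ∑ k, w k := by
    have := pow_le_pow_left₀ hm0.le hmS 2
    rwa [Real.sq_sqrt hS0] at this
  have hεm : 256 * (s + 1) ≤ ε * m := by nlinarith
  have hL0 : 1 / 2 ≤ L := by
    have h2 : (2 : ℝ) ≤ 2 * n / δ := by rw [le_div_iff₀ hδ0]; nlinarith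
    have := Real.log_le_log two_pos h2
    have := Real.log_two_gt_d9
    linarith
  have hss : s ^ 2 = 4 * m * L := Real.sq_sqrt (by positivity)
  have hspos : 0 < s := Real.sqrt_pos.2 (by positivity)
  have hsm : 256 * s ≤ m := by nlinarith
  have hsL : 1024 * L ≤ s := by
    refine le_of_mul_le_mul_left ?_ hspos
    nlinarith
  have hk3 : (⌈L⌉₊ : ℝ) ≤ 3 * L := by
    have := Nat.ceil_lt_add_one (by linarith : 0 ≤ L)
    linarith
  have he : Real.exp 1 * Real.exp 3 ≤ 55 := by
    have h1 := Real.exp_one_lt_d9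
    have h2 : Real.exp 3 = Real.exp 1 ^ 3 := by rw [← Real.exp_nat_mul]; norm_num
    rw [h2, ← pow_succ']
    calc Real.exp 1 ^ (3 + 1) ≤ 2.7182818286 ^ (3 + 1) :=
          pow_le_pow_left₀ (Real.exp_pos _).le h1.le _
      _ ≤ 55 := by norm_num
  have hmul : ∀ r : ℝ, 0 ≤ r →
      Real.exp 1 * Real.exp 3 * (⌈L⌉₊ * r) ≤ 55 * (3 * L * r) := by
    intro r hr
    exact mul_le_mul he (mul_le_mul_of_nonneg_right hk3 hr) (by positivity) (by norm_num)
  -- The moment order `⌈L⌉₊` makes `exp k ≥ 2n/δ`, and `m` is the largest expected degree.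
  refine ⟨⌈L⌉₊, m, ?_, hm0, ?_, ?_, hwm, ?_, hm2, ?_, hn, ?_, ?_⟩
  · exact (Nat.ceil_pos.2 (by linarith)).ne'
  · linarith
  · nlinarith
  · nlinarith
  · have h1 : Real.exp L ≤ Real.exp 1 ^ ⌈L⌉₊ := by
      rw [← Real.exp_nat_mul, mul_one]
      exact Real.exp_le_exp.2 (Nat.le_ceil L)
    rw [hL, Real.exp_log (by positivity), div_le_iff₀ hδ0] at h1
    linarith
  · have h1 : √(Real.exp 1 * (4 * ⌈L⌉₊ * (Real.exp 3 * m))) ≤ 13 * s := by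
      refine Real.sqrt_le_iff.2 ⟨by positivity, ?_⟩
      have := hmul m hm0.le
      rw [mul_pow, hss]
      nlinarith
    linarith
  · refine Real.sqrt_le_iff.2 ⟨by positivity, ?_⟩
    have h1 := hmul _ hS0
    have h2 : 330 * L ≤ ε ^ 2 * d := by linarith
    have h3 := mul_le_mul_of_nonneg_right h2 hS0
    rw [mul_pow, mul_pow, hwsq]
    nlinarith

end GW

/-! ### High-probability bounds from the moments. -/

section Concentration

variable {n : ℕ}

/-- Outside a set of configurations of small probability, the adjacency matrix and the degree
vector of a random graph are close to their expectations. -/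
theorem exists_exceptional_set {p : Edge n → ℝ} (hp : ∀ e, p e ∈ Set.Icc (0 : ℝ) 1) {m S : ℝ}
    {k : ℕ} (hm : 0 < m) (hk : k ≠ 0) (hkm : (k : ℝ) ≤ m) (hmS : m ≤ S)
    (hpm : ∀ i, ∑ j, p (edgeKey i j) ≤ m) (hpS : ∑ e, p e ≤ S) :
    ∃ B : Finset (Edge n → Bool), ∑ x ∈ B, bernoulliWeight p x ≤ (n + 1) / Real.exp 1 ^ k ∧
      ∀ x ∉ B, (∀ y : Fin n → ℝ, |y ⬝ᵥ (centeredMatrix p x *ᵥ y)| ≤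
          √(Real.exp 1 * (4 * k * (Real.exp 3 * m))) * (y ⬝ᵥ y)) ∧
        ‖degreeVector (centeredMatrix p x)‖ ≤ √(Real.exp 1 * (8 * k * (Real.exp 3 * S))) := by
  classical
  have hS : 0 < S := hm.trans_le hmS
  have hk0 : (0 : ℝ) < k := by exact_mod_cast Nat.pos_of_ne_zero hk
  have hs : ∀ x, (centeredMatrix p x).IsSymm := fun x => symMatrix_isSymm _
  set M₁ := 4 * k * (Real.exp 3 * m) with hM₁
  set M₂ := 8 * k * (Real.exp 3 * S) with hM₂
  have h₁ : 0 < M₁ := by positivity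
  have h₂ : 0 < M₂ := by positivity
  have hf₁ : ∀ x, 0 ≤ (centeredMatrix p x ^ (2 * k)).trace := fun x =>
    Finset.sum_nonneg fun i _ => diag_even_pow_nonneg (hs x) k i
  -- Inflating the base of the moment bound by `Real.exp 1` gains a factor `exp (-k)` in Markov's
  -- inequality. The two failure probabilities are `n / exp k` and `1 / exp k`.
  have m₁ := (bernoulliMean_markov hp _ hf₁ (pow_pos (mul_pos (Real.exp_pos 1) h₁) k)).trans
    (div_le_div_of_nonneg_right (bernoulliMean_trace_pow_le hp hm hk hkm hpm) (by positivity))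
  have m₂ := (bernoulliMean_markov hp (fun x => ‖degreeVector (centeredMatrix p x)‖ ^ (2 * k))
    (fun x => by positivity) (pow_pos (mul_pos (Real.exp_pos 1) h₂) k)).trans
    (div_le_div_of_nonneg_right (bernoulliMean_norm_pow_le hp hS hk (hkm.trans hmS) hpS)
      (by positivity))
  have e : ∀ a M : ℝ, 0 < M → a * M ^ k / (Real.exp 1 * M) ^ k = a / Real.exp 1 ^ k := by
    intro a M hM
    rw [mul_pow, mul_div_mul_right _ _ (by positivity)]
  rw [← hM₁, e n M₁ h₁] at m₁
  rw [← hM₂, ← one_mul (M₂ ^ k), e 1 M₂ h₂] at m₂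
  refine ⟨Finset.univ.filter (fun x => (Real.exp 1 * M₁) ^ k ≤
    (centeredMatrix p x ^ (2 * k)).trace) ∪ Finset.univ.filter (fun x => (Real.exp 1 * M₂) ^ k ≤
      ‖degreeVector (centeredMatrix p x)‖ ^ (2 * k)), ?_, fun x hx => ?_⟩
  · rw [add_div]
    refine le_trans ?_ (add_le_add m₁ m₂)
    rw [← Finset.sum_union_inter]
    exact le_add_of_nonneg_right (Finset.sum_nonneg fun x _ => bernoulliWeight_nonneg hp x)
  · rw [Finset.mem_union, not_or] at hx
    obtain ⟨hx₁, hx₂⟩ := hx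
    have hx₁' : (centeredMatrix p x ^ (2 * k)).trace ≤ (Real.exp 1 * M₁) ^ k := by
      by_contra! h
      exact hx₁ (Finset.mem_filter.2 ⟨Finset.mem_univ x, h.le⟩)
    have hx₂' : ‖degreeVector (centeredMatrix p x)‖ ^ (2 * k) ≤ (Real.exp 1 * M₂) ^ k := by
      by_contra! h
      exact hx₂ (Finset.mem_filter.2 ⟨Finset.mem_univ x, h.le⟩)
    constructor
    · refine abs_dotProduct_mulVec_le_of_trace_le (hs x) hk (Real.sqrt_nonneg _) ?_
      rwa [Real.sq_sqrt (by positivity)]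
    · rw [pow_mul] at hx₂'
      exact Real.le_sqrt_of_sq_le (le_of_pow_le_pow_left₀ hk (by positivity) hx₂')

end Concentration

end NetworkIntervention

end

/-! ### Assembly of the theorem. -/

open NetworkIntervention in
theorem mainTheorem7 :
    ∃ K : ℝ, 0 < K ∧
      ∀ (n : ℕ) (w : EuclideanSpace ℝ (Fin n)) (ε δ : ℝ) (loops : Bool),
        (∀ i, 0 ≤ w i) →
        (∀ i, w i ≤ √(∑ k, w k)) →
        NetworkIntervention.GWConcentration w ε δ →
        ∀ {Ω : Type*} [MeasurableSpace Ω] (P : Measure Ω) [IsProbabilityMeasure P]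
          (A : Ω → Matrix (Fin n) (Fin n) ℝ),
          NetworkIntervention.IsIndepEdgeGraph P (NetworkIntervention.gwMatrix loops w) A →
          1 - K * δ ≤ P.real {ω |
            ‖w - NetworkIntervention.degreeVector (A ω)‖ ≤ K * (ε * ‖w‖) ∧
            ∀ (b : EuclideanSpace ℝ (Fin n)) (β C : ℝ),
              (∀ i, 0 ≤ b i) →
              0 < β →
              spectralRadius ℝ (A ω) < ENNReal.ofReal (1 / β) →
              0 < C →
              256 * ‖b‖ ^ 2 / (ε * β * NetworkIntervention.secondOrderAvg w) ^ 2 ≤ C →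
              ∀ z : EuclideanSpace ℝ (Fin n),
                NetworkIntervention.IsOptimalIntervention (A ω) β b C z →
                1 - K * ε ≤
                  NetworkIntervention.welfare (A ω) β b
                      (NetworkIntervention.degreeIntervention (A ω) C) /
                    NetworkIntervention.welfare (A ω) β b z} := by
  refine ⟨16, by norm_num, ?_⟩
  intro n w ε δ loops hw hwS hconc Ω _ P _ A hA
  obtain ⟨hε0, hε1⟩ := hconc.eps_mem
  obtain ⟨hδ0, hδ1⟩ := hconc.delta_mem
  obtain ⟨k, m, hk, hm, hkm, hmS, hwm, hmε, hm2, hnδ, hn, hop, hvec⟩ := hconc.bounds hw hwS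
  set S := ∑ i, w i with hS
  have hSpos : 0 < S := hm.trans_le hmS
  set d := secondOrderAvg w with hd
  have hdpos : 0 < d := by
    have : 0 < ε ^ 2 * d := by
      have := Real.sqrt_nonneg (Real.exp 1 * (4 * k * (Real.exp 3 * m)))
      linarith
    exact pos_of_mul_pos_right this (sq_nonneg ε)
  have hwsq : ‖w‖ ^ 2 = d * S := by
    rw [hd, secondOrderAvg, div_mul_cancel₀ _ hSpos.ne', EuclideanSpace.norm_sq_eq]
    simp only [Real.norm_eq_abs, sq_abs]
  have hw0 : w ≠ 0 := by
    rintro rfl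
    rw [norm_zero] at hwsq
    nlinarith [mul_pos hdpos hSpos]
  have hwpos : 0 < ‖w‖ := norm_pos_iff.2 hw0
  have hloop0 : ∀ i, 0 ≤ loopWeight loops w i := fun i => by
    unfold loopWeight
    split_ifs
    · exact div_nonneg (mul_self_nonneg _) hSpos.le
    · exact le_rfl
  have hloop1 : ∀ i, loopWeight loops w i ≤ 1 := fun i => by
    unfold loopWeight
    split_ifs
    · rw [div_le_one hSpos]
      nlinarith [hw i, hwm i]
    · exact zero_le_one
  have hloopε : ∀ i, loopWeight loops w i ≤ ε * w i := fun i => by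
    unfold loopWeight
    split_ifs
    · rw [div_le_iff₀ hSpos]
      nlinarith [mul_le_mul_of_nonneg_left ((hwm i).trans hmε) (hw i)]
    · exact mul_nonneg hε0.le (hw i)
  set q := gwMatrix loops w with hq
  set p : Edge n → ℝ := fun e => q e.1.1 e.1.2 with hp
  have hqp : symMatrix p = q := symMatrix_apply_of_isSymm (gwMatrix_isSymm loops w)
  have hqp' : ∀ i j, p (edgeKey i j) = q i j := fun i j => congrFun (congrFun hqp i) j
  have hp01 : ∀ e, p e ∈ Set.Icc (0 : ℝ) 1 := fun e => by
    have : P.real {ω | A ω e.1.1 e.1.2 = 1} = p e := hA.prob_edge _ _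
    rw [← this]
    exact ⟨measureReal_nonneg, measureReal_le_one⟩
  have hrow : ∀ i, ∑ j, q i j = w i - loopWeight loops w i := gwMatrix_sum_apply loops hSpos.ne'
  have hpm : ∀ i, ∑ j, p (edgeKey i j) ≤ m := fun i => by
    simp only [hqp', hrow]
    linarith [hwm i, hloop0 i]
  have hpS : ∑ e, p e ≤ S := by
    refine (sum_edge_le_sum_sum fun e => (hp01 e).1).trans ?_
    simp only [hqp', hrow]
    exact Finset.sum_le_sum fun i _ => by linarith [hloop0 i]
  obtain ⟨B, hB, hgood⟩ := exists_exceptional_set hp01 hm hk hkm hmS hpm hpS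
  have hBδ : ∑ x ∈ B, bernoulliWeight p x ≤ δ := by
    refine hB.trans ?_
    rw [div_le_iff₀ (by positivity)]
    have : (1 : ℝ) ≤ n := by exact_mod_cast hn
    linarith
  refine le_trans ?_ (hA.one_sub_le_prob B fun ω hω => ?_)
  · linarith
  obtain ⟨hquad, hdeg⟩ := hgood _ hω
  have hH : centeredMatrix p (configuration (A ω)) = A ω - q := by
    conv_rhs => rw [← hqp, ← symMatrix_configuration (hA.isSymm ω) (hA.zero_or_one ω)]
    rfl
  rw [hH] at hquad hdeg
  -- Random fluctuation accounts for `2 ε ‖w‖` and discarded self-loops for `ε ‖w‖`.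
  have hdist : ‖w - degreeVector (A ω)‖ ≤ 3 * (ε * ‖w‖) := by
    have h1 : w - degreeVector (A ω) =
        WithLp.toLp 2 (loopWeight loops w) - degreeVector (A ω - q) := by
      ext i
      simp only [degreeVector, PiLp.sub_apply, Matrix.sub_apply, Finset.sum_sub_distrib, hrow]
      ring
    have h2 : ‖WithLp.toLp 2 (loopWeight loops w)‖ ≤ ε * ‖w‖ := by
      refine le_of_sq_le_sq ?_ (by positivity)
      rw [mul_pow, EuclideanSpace.norm_sq_eq, EuclideanSpace.norm_sq_eq, Finset.mul_sum]
      refine Finset.sum_le_sum fun i _ => ?_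
      simp only [Real.norm_eq_abs, sq_abs]
      rw [← mul_pow]
      exact pow_le_pow_left₀ (hloop0 i) (hloopε i) 2
    rw [h1]
    have := norm_sub_le (WithLp.toLp 2 (loopWeight loops w)) (degreeVector (A ω - q))
    linarith
  -- The discarded diagonal has entries in `[0, 1]` and shifts the form by at most `‖x‖ ^ 2`; the `+
  -- 1` in `hop` pays for it.
  have hform : ∀ x : EuclideanSpace ℝ (Fin n),
      |x.ofLp ⬝ᵥ (A ω *ᵥ x.ofLp) - d * (inner ℝ w x / ‖w‖) ^ 2| ≤
        ε ^ 2 * d / 16 * ‖x‖ ^ 2 := by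
    intro x
    have h1 := hquad x.ofLp
    have h2 := dotProduct_gwMatrix_mulVec loops w x.ofLp
    rw [← hq] at h2
    rw [Matrix.sub_mulVec, dotProduct_sub, h2, ← norm_sq_eq_dotProduct,
      ← inner_eq_dotProduct w x, ← hS] at h1
    have h3 : d * (inner ℝ w x / ‖w‖) ^ 2 = inner ℝ w x ^ 2 / S := by
      rw [div_pow, hwsq]; field_simp
    have h4 : 0 ≤ ∑ i, loopWeight loops w i * x i ^ 2 :=
      Finset.sum_nonneg fun i _ => mul_nonneg (hloop0 i) (sq_nonneg _)
    have h5 : ∑ i, loopWeight loops w i * x i ^ 2 ≤ ‖x‖ ^ 2 := by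
      rw [EuclideanSpace.norm_sq_eq]
      refine Finset.sum_le_sum fun i _ => ?_
      rw [Real.norm_eq_abs, sq_abs]
      exact mul_le_of_le_one_left (sq_nonneg _) (hloop1 i)
    have h6 := mul_le_mul_of_nonneg_right hop (sq_nonneg ‖x‖)
    rw [h3]
    rw [abs_le] at h1 ⊢
    constructor <;> linarith [h1.1, h1.2]
  refine ⟨?_, fun b β C hb hβ hr hC hbC z hz => ?_⟩
  · nlinarith [mul_pos hε0 hwpos]
  -- Otherwise `1 - 16 ε ≤ 0`, and the ratio is nonnegative because welfare is.
  · by_cases hε16 : 16 * ε < 1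
    · exact welfare_ratio_ge (hA.isSymm ω) hw0 hdpos hε0 hε16 hform hdist hβ hr hC hbC hz
    · refine le_trans (by linarith) (div_nonneg ?_ ?_) <;>
      · rw [welfare_eq hβ hr]
        positivity
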